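/- **Language.** Terms are considered up to renaming of bound variables. Values $v ::= x \mid () \mid \mathtt{true}\mid\mathtt{false}\mid \mathtt{fun}\,x\mapsto c\mid \mathtt{handler}\,(\{\mathtt{return}\,x\mapsto c_r\}\cup h)$; computations $c ::= \mathtt{if}\,v\,\mathtt{then}\,c_1\,\mathtt{else}\,c_2\mid v_1\,v_2\mid \mathtt{return}\,v\mid op(v;y.c)\mid \mathtt{do}\,x\leftarrow c_1\,\mathtt{in}\,c_2\mid \mathtt{with}\,v\,\mathtt{handle}\,c$; operation clauses $h=\{op(x;k)\mapsto c_{op}\}_{op}$, a finite set with at most one clause for each operation. The relation $\leadsto$ is the least one that is closed under the evaluation contexts $\mathtt{do}\,x\leftarrow[\,]\,\mathtt{in}\,c_2$ and $\mathtt{with}\,v\,\mathtt{handle}\,[\,]$ and contains the following reductions, where $H=\mathtt{handler}\,(\{\mathtt{return}\,x\mapsto c_r\}\cup h)$: * $\mathtt{if}\,\mathtt{true}\,\mathtt{then}\,c_1\,\mathtt{else}\,c_2\leadsto c_1$ and $\mathtt{if}\,\mathtt{false}\,\mathtt{then}\,c_1\,\mathtt{else}\,c_2\leadsto c_2$; *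 $(\mathtt{fun}\,x\mapsto c)\,v\leadsto c[v/x]$; * $\mathtt{do}\,x\leftarrow\mathtt{return}\,v\,\mathtt{in}\,c\leadsto c[v/x]$ and $\mathtt{do}\,x\leftarrow op(v;y.c_1)\,\mathtt{in}\,c_2\leadsto op(v;y.\,\mathtt{do}\,x\leftarrow c_1\,\mathtt{in}\,c_2)$; * $\mathtt{with}\,H\,\mathtt{handle}\,\mathtt{return}\,v\leadsto c_r[v/x]$ and, if $(op(x;k)\mapsto c_{op})\in h$, $\mathtt{with}\,H\,\mathtt{handle}\,op(v;y.c)\leadsto c_{op}[v/x,(\mathtt{fun}\,y\mapsto\mathtt{with}\,H\,\mathtt{handle}\,c)/k]$. **Types.** Value types $A,B ::= \mathtt{unit}\mid\mathtt{bool}\mid A\to\underline C\mid\underline C\Rightarrow\underline D$; computation types $\underline C ::= A\,!\,\Sigma/\mathcal E$, where the signature $\Sigma$ is a finite set of operations $op:A_{op}\to B_{op}$ with distinct names, and the theory $\mathcal E$ is a finite set of equations $(x_i:A_i)_i;(z_j:B_j\to *)_j\vdash T_1\sim T_2$ between templates $T ::= z(v)\mid \mathtt{if}\,v\,\mathtt{then}\,T_1\,\mathtt{else}\,T_2\mid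 op(v;y.T)$. A type is well-formed if each theory in it has well-typed templates over its signature; a template is typed like the corresponding computation, with $z(v)$ well-typed if $z:A\to *$ and $v:A$. All types and contexts in the judgements below are well-formed. **Logic $\mathcal L_{eq}$.** The well-formedness judgements, the typing judgements $\Gamma\vdash v:A$, $\Gamma\vdash c:\underline C$, the judgement $\Gamma\vdash h:\Sigma\to\underline D$ ($h$ has a clause for exactly the operations of $\Sigma$, and $\Gamma,x:A_{op},k:B_{op}\to\underline D\vdash c_{op}:\underline D$ for each of them), the judgement "$h:\Sigma\to\underline D$ respects $\mathcal E$ in $\Gamma$", and the equations $\Gamma\vdash v\equiv_A v'$, $\Gamma\vdash c\equiv_{\underline C}c'$ are defined by one simultaneous induction. * Typing is the usual one for fine-grain call-by-value: $\mathtt{return}\,v:A\,!\,\Sigma/\mathcal E$ if $v:A$; $op(v;y.c):A\,!\,\Sigma/\mathcal E$ if $op:A_{op}\to B_{op}\in\Sigma$, $v:A_{op}$ and $y:B_{op}\vdash c:A\,!\,\Sigma/\mathcal E$; in $\mathtt{do}\,x\leftarrow c_1\,\mathtt{in}\,c_2$ both computations have the same $\Sigma/\mathcal E$; $\mathtt{with}\,v\,\mathtt{handle}\,c:\underline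 D$ if $v:\underline C\Rightarrow\underline D$ and $c:\underline C$; and $\Gamma\vdash\mathtt{handler}\,(\{\mathtt{return}\,x\mapsto c_r\}\cup h):A\,!\,\Sigma/\mathcal E\Rightarrow\underline D$ if $\Gamma,x:A\vdash c_r:\underline D$ and $h:\Sigma\to\underline D$ respects $\mathcal E$ in $\Gamma$. * Every $\Gamma\vdash h:\Sigma\to\underline D$ respects $\emptyset$. If $h$ respects $\mathcal E$ and $\Gamma,(x_i:A_i)_i,(f_j:B_j\to\underline D)_j\vdash T_1^h[f_j/z_j]_j\equiv_{\underline D}T_2^h[f_j/z_j]_j$, then $h$ respects $\mathcal E\cup\{(x_i:A_i)_i;(z_j:B_j\to *)_j\vdash T_1\sim T_2\}$. Here $T^h[f_j/z_j]_j$ replaces $z_j(v)$ by $f_j\,v$, commutes with conditionals, and replaces $op(v;y.T)$ by $c_{op}[v/x,(\mathtt{fun}\,y\mapsto T^h[f_j/z_j]_j)/k]$. * The equations are closed under reflexivity, symmetry, transitivity, substitution of well-typed values for variables, congruence for every term constructor, the $\beta$-laws (one for each reduction above, other than the closure under evaluation contexts), and the $\eta$-laws $v\equiv_{\mathtt{unit}}()$;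 $v\equiv_{A\to\underline C}\mathtt{fun}\,x\mapsto v\,x$; $c[v/x]\equiv\mathtt{if}\,v\,\mathtt{then}\,c[\mathtt{true}/x]\,\mathtt{else}\,c[\mathtt{false}/x]$ for $v:\mathtt{bool}$; $c\equiv\mathtt{do}\,x\leftarrow c\,\mathtt{in}\,\mathtt{return}\,x$. Moreover, if $\underline C=A\,!\,\Sigma/\mathcal E$, $((x_i:A_i)_i;(z_j:B_j\to *)_j\vdash T_1\sim T_2)\in\mathcal E$, $\Gamma\vdash v_i:A_i$ and $\Gamma\vdash f_j:B_j\to\underline C$ for all $i,j$, then $\Gamma\vdash T_1[f_j/z_j]_j[v_i/x_i]_i\equiv_{\underline C}T_2[f_j/z_j]_j[v_i/x_i]_i$. **Contextual equivalence.** A *ground computation context* for $\Gamma$ and a type $\underline C$ (or $A$) is a computation $\mathbb C$ with any number of holes, possibly under binders, that can be typed as a closed computation of type $\mathtt{bool}\,!\,\emptyset/\emptyset$ by the above typing rules, where a hole is typed as a term of that type $\underline C$ (or $A$) in context $\Gamma$ (every variable of $\Gamma$ being in scope at the hole, with its type in $\Gamma$), and where clauses with holes are required to respect a theory whenever any term of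 that type in context $\Gamma$ is plugged into the holes. Two terms of the same type in context $\Gamma$ are *contextually equivalent*, written $\simeq$, if for every such $\mathbb C$ plugging the first one yields a computation with $\mathbb C[\cdot]\leadsto^*\mathtt{return}\,\mathtt{true}$ if and only if plugging the second one does. **Corollary.** If $\Gamma\vdash v_1\equiv_A v_2$ is derivable in $\mathcal L_{eq}$, then $v_1$ and $v_2$ are well-typed values of type $A$ in $\Gamma$ and $v_1\simeq v_2$ at type $A$. If $\Gamma\vdash c_1\equiv_{\underline C}c_2$ is derivable in $\mathcal L_{eq}$, then $c_1$ and $c_2$ are well-typed computations of type $\underline C$ in $\Gamma$ and $c_1\simeq c_2$ at type $\underline C$. -/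

import Mathlib

namespace LocalEff

/-! Terms are represented with de Bruijn indices; operation names and indices are natural numbers.
Index `0` is the most recently bound variable. -/

mutual
/-- Values. -/
inductive Val : Type
  | var (n : ℕ)
  | unit
  | tt
  | ff
  /-- `fun x ↦ c`; the body binds one variable. -/
  | fn (c : Comp)
  /-- `handler {return x ↦ cr} ∪ h`; the return clause `cr` binds one variable. -/
  | handler (cr : Comp) (h : Clauses)
/-- Computations. -/
inductive Comp : Type
  | ite (v : Val) (c₁ c₂ : Comp)
  | app (v₁ v₂ : Val)
  | ret (v : Val)
  /-- operation call `o(v; y. c)`; `c` binds `y`. -/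
  | op (o : ℕ) (v : Val) (c : Comp)
  /-- `do x ← c₁ in c₂`; `c₂` binds `x`. -/
  | bind (c₁ c₂ : Comp)
  /-- `with v handle c`. -/
  | handle (v : Val) (c : Comp)
/-- Operation clauses. In `cons o c h` the clause `o(x; k) ↦ c` binds two variables in `c`:
`k` has index `0` and `x` has index `1`. -/
inductive Clauses : Type
  | nil
  | cons (o : ℕ) (c : Comp) (h : Clauses)
end

/-- The clause assigned to an operation. -/
def Clauses.lookup : Clauses → ℕ → Option Comp
  | .nil, _ => none
  | .cons o c h, o' => if o' = o then some c else h.lookup o'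

/-- The operations listed in the clauses. -/
def Clauses.ops : Clauses → List ℕ
  | .nil => []
  | .cons o _ h => o :: h.ops

/-! ### Renaming and (capture-avoiding, simultaneous) substitution -/

/-- Renaming under a binder. -/
def liftRen (ρ : ℕ → ℕ) : ℕ → ℕ
  | 0 => 0
  | n + 1 => ρ n + 1

mutual
def Val.rename : Val → (ℕ → ℕ) → Val
  | .var n, ρ => .var (ρ n)
  | .unit, _ => .unit
  | .tt, _ => .tt
  | .ff, _ => .ff
  | .fn c, ρ => .fn (c.rename (liftRen ρ))
  | .handler cr h, ρ => .handler (cr.rename (liftRen ρ)) (h.rename ρ)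
def Comp.rename : Comp → (ℕ → ℕ) → Comp
  | .ite v c₁ c₂, ρ => .ite (v.rename ρ) (c₁.rename ρ) (c₂.rename ρ)
  | .app v₁ v₂, ρ => .app (v₁.rename ρ) (v₂.rename ρ)
  | .ret v, ρ => .ret (v.rename ρ)
  | .op o v c, ρ => .op o (v.rename ρ) (c.rename (liftRen ρ))
  | .bind c₁ c₂, ρ => .bind (c₁.rename ρ) (c₂.rename (liftRen ρ))
  | .handle v c, ρ => .handle (v.rename ρ) (c.rename ρ)
def Clauses.rename : Clauses → (ℕ → ℕ) → Clauses
  | .nil, _ => .nil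
  | .cons o c h, ρ => .cons o (c.rename (liftRen (liftRen ρ))) (h.rename ρ)
end

/-- Weakening by one variable. -/
abbrev Val.shift (v : Val) : Val := v.rename Nat.succ

/-- Substitution under a binder. -/
def liftSub (σ : ℕ → Val) : ℕ → Val
  | 0 => .var 0
  | n + 1 => (σ n).shift

mutual
def Val.subst : Val → (ℕ → Val) → Val
  | .var n, σ => σ n
  | .unit, _ => .unit
  | .tt, _ => .tt
  | .ff, _ => .ff
  | .fn c, σ => .fn (c.subst (liftSub σ))
  | .handler cr h, σ => .handler (cr.subst (liftSub σ)) (h.subst σ)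
def Comp.subst : Comp → (ℕ → Val) → Comp
  | .ite v c₁ c₂, σ => .ite (v.subst σ) (c₁.subst σ) (c₂.subst σ)
  | .app v₁ v₂, σ => .app (v₁.subst σ) (v₂.subst σ)
  | .ret v, σ => .ret (v.subst σ)
  | .op o v c, σ => .op o (v.subst σ) (c.subst (liftSub σ))
  | .bind c₁ c₂, σ => .bind (c₁.subst σ) (c₂.subst (liftSub σ))
  | .handle v c, σ => .handle (v.subst σ) (c.subst σ)
def Clauses.subst : Clauses → (ℕ → Val) → Clauses
  | .nil, _ => .nil
  | .cons o c h, σ => .cons o (c.subst (liftSub (liftSub σ))) (h.subst σ)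
end

/-- The substitution `[v / x]` for the last bound variable. -/
def one (v : Val) : ℕ → Val
  | 0 => v
  | n + 1 => .var n

/-- The substitution `[v / x, w / k]` used for an operation clause. -/
def two (v w : Val) : ℕ → Val
  | 0 => w
  | 1 => v
  | n + 2 => .var n

/-! ### Operational semantics -/

/-- Small-step reduction. -/
inductive Step : Comp → Comp → Prop
  | ite_tt (c₁ c₂ : Comp) : Step (.ite .tt c₁ c₂) c₁
  | ite_ff (c₁ c₂ : Comp) : Step (.ite .ff c₁ c₂) c₂
  | app_fn (c : Comp) (v : Val) : Step (.app (.fn c) v) (c.subst (one v))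
  | bind_step {c₁ c₁' : Comp} (c₂ : Comp) : Step c₁ c₁' → Step (.bind c₁ c₂) (.bind c₁' c₂)
  | bind_ret (v : Val) (c : Comp) : Step (.bind (.ret v) c) (c.subst (one v))
  | bind_op (o : ℕ) (v : Val) (c₁ c₂ : Comp) :
      Step (.bind (.op o v c₁) c₂) (.op o v (.bind c₁ (c₂.rename (liftRen Nat.succ))))
  | handle_step (v : Val) {c c' : Comp} : Step c c' → Step (.handle v c) (.handle v c')
  | handle_ret (cr : Comp) (h : Clauses) (v : Val) :
      Step (.handle (.handler cr h) (.ret v)) (cr.subst (one v))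
  | handle_op (cr : Comp) (h : Clauses) {o : ℕ} (v : Val) (c : Comp) {co : Comp} :
      h.lookup o = some co →
      Step (.handle (.handler cr h) (.op o v c))
        (co.subst (two v (.fn (.handle (Val.handler cr h).shift c))))

/-- Reflexive-transitive closure of reduction. -/
abbrev Steps : Comp → Comp → Prop := Relation.ReflTransGen Step

/-! ### Templates -/

/-- Templates. They have value variables (indices inside the values `v`; `op` binds one) and
template variables `z` (a separate index space, never bound inside a template). -/
inductive Tmpl : Type
  | app (z : ℕ) (v : Val)
  | ite (v : Val) (T₁ T₂ : Tmpl)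
  | op (o : ℕ) (v : Val) (T : Tmpl)

/-- The instantiation `(T[f_j / z_j]_j)[v_i / x_i]_i`, done simultaneously. -/
def Tmpl.inst : Tmpl → (f : ℕ → Val) → (σ : ℕ → Val) → Comp
  | .app z v, f, σ => .app (f z) (v.subst σ)
  | .ite v T₁ T₂, f, σ => .ite (v.subst σ) (T₁.inst f σ) (T₂.inst f σ)
  | .op o v T, f, σ => .op o (v.subst σ) (T.inst (fun j => (f j).shift) (liftSub σ))

/-- The handled template `T^h[f_j / z_j]_j`, with `σ` substituted for the value variables of `T`:
operation calls are replaced by the corresponding clauses of `h`. The `none` branch is never taken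
for a template over the signature that `h` covers. -/
def Tmpl.handled : Tmpl → (h : Clauses) → (f : ℕ → Val) → (σ : ℕ → Val) → Comp
  | .app z v, _, f, σ => .app (f z) (v.subst σ)
  | .ite v T₁ T₂, h, f, σ => .ite (v.subst σ) (T₁.handled h f σ) (T₂.handled h f σ)
  | .op o v T, h, f, σ =>
      let rest := T.handled (h.rename Nat.succ) (fun j => (f j).shift) (liftSub σ)
      match h.lookup o with
      | some co => co.subst (two (v.subst σ) (.fn rest))
      | none => .op o (v.subst σ) rest

/-! ### Types -/

mutual
/-- Value types. -/
inductive VTy : Type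
  | unit
  | bool
  | fn (A : VTy) (C : CTy)
  | handler (C D : CTy)
/-- Computation types `A ! Σ / ℰ`. -/
inductive CTy : Type
  | mk (A : VTy) (S : Sig) (E : Theory)
/-- Signatures; `cons o A B S` is `S ∪ {o : A → B}`. -/
inductive Sig : Type
  | nil
  | cons (o : ℕ) (A B : VTy) (S : Sig)
/-- Effect theories; `cons X Z T₁ T₂ E` is `E ∪ {X; Z ⊢ T₁ ∼ T₂}`. Here `X` lists the types of the
value variables, and `Z` lists, for the template variables `z : B → *`, the types `B`. -/
inductive Theory : Type
  | nil
  | cons (X Z : List VTy) (T₁ T₂ : Tmpl) (E : Theory)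
end

/-- Contexts; the head of the list is the type of the variable with index `0`. -/
abbrev Ctx := List VTy

/-- The arity `A → B` of an operation in a signature. -/
def Sig.lookup : Sig → ℕ → Option (VTy × VTy)
  | .nil, _ => none
  | .cons o A B S, o' => if o' = o then some (A, B) else S.lookup o'

/-- `(X; Z ⊢ T₁ ∼ T₂) ∈ E`. -/
def Theory.Mem (X Z : Ctx) (T₁ T₂ : Tmpl) : Theory → Prop
  | .nil => False
  | .cons X' Z' T₁' T₂' E =>
      (X = X' ∧ Z = Z' ∧ T₁ = T₁' ∧ T₂ = T₂') ∨ E.Mem X Z T₁ T₂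

/-! Signatures and theories are finite sets, so types are identified up to the order in which
operations and equations are listed and up to repetition of equations. -/

mutual
inductive VTyEq : VTy → VTy → Prop
  | unit : VTyEq .unit .unit
  | bool : VTyEq .bool .bool
  | fn {A A' C C'} : VTyEq A A' → CTyEq C C' → VTyEq (.fn A C) (.fn A' C')
  | handler {C C' D D'} : CTyEq C C' → CTyEq D D' → VTyEq (.handler C D) (.handler C' D')
inductive CTyEq : CTy → CTy → Prop
  | mk {A A' S S' E E'} :
      VTyEq A A' → SigEq S S' → TheoryEq E E' → CTyEq (.mk A S E) (.mk A' S' E')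
inductive SigEq : Sig → Sig → Prop
  | nil : SigEq .nil .nil
  | cons {o A A' B B' S S'} : VTyEq A A' → VTyEq B B' → SigEq S S' →
      SigEq (.cons o A B S) (.cons o A' B' S')
  | swap {o o' A A' B B' S} : o ≠ o' →
      SigEq (.cons o A B (.cons o' A' B' S)) (.cons o' A' B' (.cons o A B S))
  | trans {S S' S''} : SigEq S S' → SigEq S' S'' → SigEq S S''
inductive CtxEq : List VTy → List VTy → Prop
  | nil : CtxEq [] []
  | cons {A A' X X'} : VTyEq A A' → CtxEq X X' → CtxEq (A :: X) (A' :: X')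
inductive TheoryEq : Theory → Theory → Prop
  | nil : TheoryEq .nil .nil
  | cons {X X' Z Z' T₁ T₂ E E'} : CtxEq X X' → CtxEq Z Z' → TheoryEq E E' →
      TheoryEq (.cons X Z T₁ T₂ E) (.cons X' Z' T₁ T₂ E')
  | swap {X X' Z Z' T₁ T₁' T₂ T₂' E} :
      TheoryEq (.cons X Z T₁ T₂ (.cons X' Z' T₁' T₂' E))
        (.cons X' Z' T₁' T₂' (.cons X Z T₁ T₂ E))
  | dup {X Z T₁ T₂ E} :
      TheoryEq (.cons X Z T₁ T₂ (.cons X Z T₁ T₂ E)) (.cons X Z T₁ T₂ E)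
  | symm {E E'} : TheoryEq E E' → TheoryEq E' E
  | trans {E E' E''} : TheoryEq E E' → TheoryEq E' E'' → TheoryEq E E''
end

/-! ### Well-formedness, typing, and the equational logic: one simultaneous inductive definition -/

mutual
/-- Well-formed value types. -/
inductive WfV : VTy → Prop
  | unit : WfV .unit
  | bool : WfV .bool
  | fn {A C} : WfV A → WfC C → WfV (.fn A C)
  | handler {C D} : WfC C → WfC D → WfV (.handler C D)

/-- Well-formed computation types. -/
inductive WfC : CTy → Prop
  | mk {A S E} : WfV A → WfSig S → WfTheory S E → WfC (.mk A S E)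

/-- Well-formed signatures. -/
inductive WfSig : Sig → Prop
  | nil : WfSig .nil
  | cons {o A B S} : WfSig S → WfV A → WfV B → S.lookup o = none → WfSig (.cons o A B S)

/-- Well-formed contexts; used both for value contexts and for template contexts (with de Bruijn
indices there are no names to be kept distinct). -/
inductive WfCtx : Ctx → Prop
  | nil : WfCtx []
  | cons {A Γ} : WfCtx Γ → WfV A → WfCtx (A :: Γ)

/-- Well-formed templates, `X; Z ⊢ T : S`. -/
inductive WfT : Ctx → Ctx → Tmpl → Sig → Prop
  | app {X Z S z v A} : WfCtx Z → WfSig S → HasTyV X v A → Z[z]? = some A →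
      WfT X Z (.app z v) S
  | ite {X Z S v T₁ T₂} : HasTyV X v .bool → WfT X Z T₁ S → WfT X Z T₂ S →
      WfT X Z (.ite v T₁ T₂) S
  | op {X Z S o v T A B} : S.lookup o = some (A, B) → HasTyV X v A → WfT (B :: X) Z T S →
      WfT X Z (.op o v T) S

/-- Well-formed theories over a signature. -/
inductive WfTheory : Sig → Theory → Prop
  | nil {S} : WfSig S → WfTheory S .nil
  | cons {S E X Z T₁ T₂} : WfTheory S E → WfCtx X → WfCtx Z → WfT X Z T₁ S → WfT X Z T₂ S →
      WfTheory S (.cons X Z T₁ T₂ E)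

/-- Well-typed values, `Γ ⊢ v : A`. -/
inductive HasTyV : Ctx → Val → VTy → Prop
  | var {Γ n A} : WfCtx Γ → Γ[n]? = some A → HasTyV Γ (.var n) A
  | unit {Γ} : WfCtx Γ → HasTyV Γ .unit .unit
  | tt {Γ} : WfCtx Γ → HasTyV Γ .tt .bool
  | ff {Γ} : WfCtx Γ → HasTyV Γ .ff .bool
  | fn {Γ A C c} : HasTyC (A :: Γ) c C → HasTyV Γ (.fn c) (.fn A C)
  | handler {Γ A S E D cr h} : HasTyC (A :: Γ) cr D → Respects Γ h E S D →
      HasTyV Γ (.handler cr h) (.handler (.mk A S E) D)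
  | conv {Γ v A A'} : HasTyV Γ v A → VTyEq A A' → WfV A' → HasTyV Γ v A'

/-- Well-typed computations, `Γ ⊢ c : C`. -/
inductive HasTyC : Ctx → Comp → CTy → Prop
  | ite {Γ v c₁ c₂ C} : HasTyV Γ v .bool → HasTyC Γ c₁ C → HasTyC Γ c₂ C →
      HasTyC Γ (.ite v c₁ c₂) C
  | app {Γ v₁ v₂ A C} : HasTyV Γ v₁ (.fn A C) → HasTyV Γ v₂ A → HasTyC Γ (.app v₁ v₂) C
  | ret {Γ v A S E} : HasTyV Γ v A → WfC (.mk A S E) → HasTyC Γ (.ret v) (.mk A S E)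
  | op {Γ o v c Ao Bo A S E} : S.lookup o = some (Ao, Bo) → HasTyV Γ v Ao →
      HasTyC (Bo :: Γ) c (.mk A S E) → HasTyC Γ (.op o v c) (.mk A S E)
  | bind {Γ c₁ c₂ A B S E} : HasTyC Γ c₁ (.mk A S E) → HasTyC (A :: Γ) c₂ (.mk B S E) →
      HasTyC Γ (.bind c₁ c₂) (.mk B S E)
  | handle {Γ v c C D} : HasTyV Γ v (.handler C D) → HasTyC Γ c C → HasTyC Γ (.handle v c) D
  | conv {Γ c C C'} : HasTyC Γ c C → CTyEq C C' → WfC C' → HasTyC Γ c C'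

/-- Well-typed operation clauses: `h` has exactly one clause for each operation of `S` (and no
others), and handles it by a computation of type `D`. -/
inductive HasTyH : Ctx → Clauses → Sig → CTy → Prop
  | mk {Γ h S D} : WfCtx Γ → WfSig S → WfC D → h.ops.Nodup →
      (∀ o, h.lookup o = none ↔ S.lookup o = none) →
      (∀ o A B co, S.lookup o = some (A, B) → h.lookup o = some co →
        HasTyC (.fn B D :: A :: Γ) co D) →
      HasTyH Γ h S D

/-- Clauses `h` for the signature `S` respect the theory `E` at `D`, according to the equational
logic. In the context `Γ, (x_i : A_i)_i, (f_j : B_j → D)_j` the variable `f_j` has index `j`,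
`x_i` has index `i + Z.length`, and the variables of `Γ` come after these. -/
inductive Respects : Ctx → Clauses → Theory → Sig → CTy → Prop
  | nil {Γ h S D} : HasTyH Γ h S D → Respects Γ h .nil S D
  | cons {Γ h E S D X Z T₁ T₂} : Respects Γ h E S D → WfTheory S (.cons X Z T₁ T₂ E) →
      EqC (Z.map (fun B => VTy.fn B D) ++ (X ++ Γ))
        (T₁.handled (h.rename (fun n => n + (X.length + Z.length))) (fun j => .var j)
          (fun i => .var (i + Z.length)))
        (T₂.handled (h.rename (fun n => n + (X.length + Z.length))) (fun j => .var j)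
          (fun i => .var (i + Z.length))) D →
      Respects Γ h (.cons X Z T₁ T₂ E) S D

/-- Derivable equations between values, `Γ ⊢ v ≡ v' : A`. -/
inductive EqV : Ctx → Val → Val → VTy → Prop
  | refl {Γ v A} : HasTyV Γ v A → EqV Γ v v A
  | symm {Γ v w A} : EqV Γ v w A → EqV Γ w v A
  | trans {Γ u v w A} : EqV Γ u v A → EqV Γ v w A → EqV Γ u w A
  | conv {Γ v w A A'} : EqV Γ v w A → VTyEq A A' → WfV A' → EqV Γ v w A'
  | subst {Γ Δ v w A} {σ : ℕ → Val} : EqV Γ v w A → WfCtx Δ →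
      (∀ i B, Γ[i]? = some B → HasTyV Δ (σ i) B) → EqV Δ (v.subst σ) (w.subst σ) A
  -- congruences
  | fn {Γ A C c c'} : EqC (A :: Γ) c c' C → EqV Γ (.fn c) (.fn c') (.fn A C)
  | handler {Γ A S E D cr cr' h h'} : EqC (A :: Γ) cr cr' D →
      Respects Γ h E S D → Respects Γ h' E S D →
      (∀ o Ao Bo co co', S.lookup o = some (Ao, Bo) → h.lookup o = some co →
        h'.lookup o = some co' → EqC (.fn Bo D :: Ao :: Γ) co co' D) →
      EqV Γ (.handler cr h) (.handler cr' h') (.handler (.mk A S E) D)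
  -- eta
  | eta_unit {Γ v} : HasTyV Γ v .unit → EqV Γ v .unit .unit
  | eta_fn {Γ v A C} : HasTyV Γ v (.fn A C) →
      EqV Γ v (.fn (.app v.shift (.var 0))) (.fn A C)

/-- Derivable equations between computations, `Γ ⊢ c ≡ c' : C`. -/
inductive EqC : Ctx → Comp → Comp → CTy → Prop
  | refl {Γ c C} : HasTyC Γ c C → EqC Γ c c C
  | symm {Γ c d C} : EqC Γ c d C → EqC Γ d c C
  | trans {Γ c d e C} : EqC Γ c d C → EqC Γ d e C → EqC Γ c e C
  | conv {Γ c d C C'} : EqC Γ c d C → CTyEq C C' → WfC C' → EqC Γ c d C'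
  | subst {Γ Δ c d C} {σ : ℕ → Val} : EqC Γ c d C → WfCtx Δ →
      (∀ i B, Γ[i]? = some B → HasTyV Δ (σ i) B) → EqC Δ (c.subst σ) (d.subst σ) C
  -- congruences
  | ite {Γ v v' c₁ c₁' c₂ c₂' C} : EqV Γ v v' .bool → EqC Γ c₁ c₁' C → EqC Γ c₂ c₂' C →
      EqC Γ (.ite v c₁ c₂) (.ite v' c₁' c₂') C
  | app {Γ v v' w w' A C} : EqV Γ v v' (.fn A C) → EqV Γ w w' A →
      EqC Γ (.app v w) (.app v' w') C
  | ret {Γ v v' A S E} : EqV Γ v v' A → WfC (.mk A S E) →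
      EqC Γ (.ret v) (.ret v') (.mk A S E)
  | op {Γ o v v' c c' Ao Bo A S E} : S.lookup o = some (Ao, Bo) → EqV Γ v v' Ao →
      EqC (Bo :: Γ) c c' (.mk A S E) → EqC Γ (.op o v c) (.op o v' c') (.mk A S E)
  | bind {Γ c₁ c₁' c₂ c₂' A B S E} : EqC Γ c₁ c₁' (.mk A S E) →
      EqC (A :: Γ) c₂ c₂' (.mk B S E) → EqC Γ (.bind c₁ c₂) (.bind c₁' c₂') (.mk B S E)
  | handle {Γ v v' c c' C D} : EqV Γ v v' (.handler C D) → EqC Γ c c' C →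
      EqC Γ (.handle v c) (.handle v' c') D
  -- beta
  | beta_tt {Γ c₁ c₂ C} : HasTyC Γ c₁ C → HasTyC Γ c₂ C → EqC Γ (.ite .tt c₁ c₂) c₁ C
  | beta_ff {Γ c₁ c₂ C} : HasTyC Γ c₁ C → HasTyC Γ c₂ C → EqC Γ (.ite .ff c₁ c₂) c₂ C
  | beta_fn {Γ c v A C} : HasTyC (A :: Γ) c C → HasTyV Γ v A →
      EqC Γ (.app (.fn c) v) (c.subst (one v)) C
  | beta_bind_ret {Γ v c A B S E} : HasTyV Γ v A → HasTyC (A :: Γ) c (.mk B S E) →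
      EqC Γ (.bind (.ret v) c) (c.subst (one v)) (.mk B S E)
  | beta_bind_op {Γ o v c₁ c₂ Ao Bo A B S E} : S.lookup o = some (Ao, Bo) → HasTyV Γ v Ao →
      HasTyC (Bo :: Γ) c₁ (.mk A S E) → HasTyC (A :: Γ) c₂ (.mk B S E) →
      EqC Γ (.bind (.op o v c₁) c₂) (.op o v (.bind c₁ (c₂.rename (liftRen Nat.succ))))
        (.mk B S E)
  | beta_handle_ret {Γ cr h v A S E D} : HasTyC (A :: Γ) cr D → Respects Γ h E S D →
      HasTyV Γ v A →
      EqC Γ (.handle (.handler cr h) (.ret v)) (cr.subst (one v)) D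
  | beta_handle_op {Γ cr h o v c co Ao Bo A S E D} : HasTyC (A :: Γ) cr D →
      Respects Γ h E S D → S.lookup o = some (Ao, Bo) → h.lookup o = some co →
      HasTyV Γ v Ao → HasTyC (Bo :: Γ) c (.mk A S E) →
      EqC Γ (.handle (.handler cr h) (.op o v c))
        (co.subst (two v (.fn (.handle (Val.handler cr h).shift c)))) D
  -- eta
  | eta_bool {Γ v c C} : HasTyV Γ v .bool → HasTyC (.bool :: Γ) c C →
      EqC Γ (c.subst (one v)) (.ite v (c.subst (one .tt)) (c.subst (one .ff))) C
  | eta_bind {Γ c A S E} : HasTyC Γ c (.mk A S E) →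
      EqC Γ c (.bind c (.ret (.var 0))) (.mk A S E)
  /-- Inheriting equations from the effect theory. -/
  | inherit {Γ A S E X Z T₁ T₂} {f σ : ℕ → Val} : WfCtx Γ → WfC (.mk A S E) →
      E.Mem X Z T₁ T₂ →
      (∀ i B, X[i]? = some B → HasTyV Γ (σ i) B) →
      (∀ j B, Z[j]? = some B → HasTyV Γ (f j) (.fn B (.mk A S E))) →
      EqC Γ (T₁.inst f σ) (T₂.inst f σ) (.mk A S E)
end

/-! ### Contexts with holes and contextual equivalence -/

/-- The two sorts of terms. -/
inductive Kind : Type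
  | val
  | comp

/-- Terms of the given sort. -/
abbrev Tm : Kind → Type
  | .val => Val
  | .comp => Comp

/-- Types of the given sort. -/
abbrev Ty : Kind → Type
  | .val => VTy
  | .comp => CTy

/-- `Γ ⊢ t : T` for terms of the given sort. -/
abbrev HasTy : (k : Kind) → Ctx → Tm k → Ty k → Prop
  | .val => HasTyV
  | .comp => HasTyC

mutual
/-- Values with any number of holes for a term of sort `k`, possibly under binders. A hole records
by `ρ` which of the variables in scope at the hole the free variables of the inserted term become;
they may thus be captured by binders of the context. -/
inductive VCx : Kind → Type
  | hole (ρ : ℕ → ℕ) : VCx .val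
  | var {k} (n : ℕ) : VCx k
  | unit {k} : VCx k
  | tt {k} : VCx k
  | ff {k} : VCx k
  | fn {k} (c : CCx k) : VCx k
  | handler {k} (cr : CCx k) (h : HCx k) : VCx k
/-- Computations with holes for a term of sort `k`. -/
inductive CCx : Kind → Type
  | hole (ρ : ℕ → ℕ) : CCx .comp
  | ite {k} (v : VCx k) (c₁ c₂ : CCx k) : CCx k
  | app {k} (v₁ v₂ : VCx k) : CCx k
  | ret {k} (v : VCx k) : CCx k
  | op {k} (o : ℕ) (v : VCx k) (c : CCx k) : CCx k
  | bind {k} (c₁ c₂ : CCx k) : CCx k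
  | handle {k} (v : VCx k) (c : CCx k) : CCx k
/-- Operation clauses with holes for a term of sort `k`. -/
inductive HCx : Kind → Type
  | nil {k} : HCx k
  | cons {k} (o : ℕ) (c : CCx k) (h : HCx k) : HCx k
end

mutual
/-- Plugging a term into the holes. -/
def VCx.plug : {k : Kind} → VCx k → Tm k → Val
  | _, .hole ρ, t => Val.rename t ρ
  | _, .var n, _ => .var n
  | _, .unit, _ => .unit
  | _, .tt, _ => .tt
  | _, .ff, _ => .ff
  | _, .fn c, t => .fn (c.plug t)
  | _, .handler cr h, t => .handler (cr.plug t) (h.plug t)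
def CCx.plug : {k : Kind} → CCx k → Tm k → Comp
  | _, .hole ρ, t => Comp.rename t ρ
  | _, .ite v c₁ c₂, t => .ite (v.plug t) (c₁.plug t) (c₂.plug t)
  | _, .app v₁ v₂, t => .app (v₁.plug t) (v₂.plug t)
  | _, .ret v, t => .ret (v.plug t)
  | _, .op o v c, t => .op o (v.plug t) (c.plug t)
  | _, .bind c₁ c₂, t => .bind (c₁.plug t) (c₂.plug t)
  | _, .handle v c, t => .handle (v.plug t) (c.plug t)
def HCx.plug : {k : Kind} → HCx k → Tm k → Clauses
  | _, .nil, _ => .nil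
  | _, .cons o c h, t => .cons o (c.plug t) (h.plug t)
end

/-- The clause with holes assigned to an operation. -/
def HCx.lookup : {k : Kind} → HCx k → ℕ → Option (CCx k)
  | _, .nil, _ => none
  | _, .cons o c h, o' => if o' = o then some c else h.lookup o'

/-- The operations listed in clauses with holes. -/
def HCx.ops : {k : Kind} → HCx k → List ℕ
  | _, .nil => []
  | _, .cons o _ h => o :: h.ops

/-! Typing of contexts whose holes stand for terms of type `T` in context `Γ`. The rules are those
for terms, together with the rule that a hole has type `T`. The judgement that clauses respect a
theory is required for every term that may be inserted. -/

mutual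
inductive CxTyV : (k : Kind) → (Γ : Ctx) → (T : Ty k) → Ctx → VCx k → VTy → Prop
  | hole {Γ : Ctx} {T : VTy} {Δ ρ} : WfCtx Δ →
      (∀ i A, Γ[i]? = some A → HasTyV Δ (.var (ρ i)) A) →
      CxTyV .val Γ T Δ (.hole ρ) T
  | var {k Γ T Δ n A} : WfCtx Δ → Δ[n]? = some A → CxTyV k Γ T Δ (.var n) A
  | unit {k Γ T Δ} : WfCtx Δ → CxTyV k Γ T Δ .unit .unit
  | tt {k Γ T Δ} : WfCtx Δ → CxTyV k Γ T Δ .tt .bool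
  | ff {k Γ T Δ} : WfCtx Δ → CxTyV k Γ T Δ .ff .bool
  | fn {k Γ T Δ A C c} : CxTyC k Γ T (A :: Δ) c C → CxTyV k Γ T Δ (.fn c) (.fn A C)
  | handler {k Γ T Δ A S E D cr h} : CxTyC k Γ T (A :: Δ) cr D → CxTyH k Γ T Δ h S D →
      (∀ t : Tm k, HasTy k Γ t T → Respects Δ (h.plug t) E S D) →
      WfTheory S E →
      CxTyV k Γ T Δ (.handler cr h) (.handler (.mk A S E) D)
  | conv {k Γ T Δ v A A'} : CxTyV k Γ T Δ v A → VTyEq A A' → WfV A' → CxTyV k Γ T Δ v A'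
inductive CxTyC : (k : Kind) → (Γ : Ctx) → (T : Ty k) → Ctx → CCx k → CTy → Prop
  | hole {Γ : Ctx} {T : CTy} {Δ ρ} : WfCtx Δ →
      (∀ i A, Γ[i]? = some A → HasTyV Δ (.var (ρ i)) A) →
      CxTyC .comp Γ T Δ (.hole ρ) T
  | ite {k Γ T Δ v c₁ c₂ C} : CxTyV k Γ T Δ v .bool → CxTyC k Γ T Δ c₁ C →
      CxTyC k Γ T Δ c₂ C → CxTyC k Γ T Δ (.ite v c₁ c₂) C
  | app {k Γ T Δ v₁ v₂ A C} : CxTyV k Γ T Δ v₁ (.fn A C) → CxTyV k Γ T Δ v₂ A →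
      CxTyC k Γ T Δ (.app v₁ v₂) C
  | ret {k Γ T Δ v A S E} : CxTyV k Γ T Δ v A → WfC (.mk A S E) →
      CxTyC k Γ T Δ (.ret v) (.mk A S E)
  | op {k Γ T Δ o v c Ao Bo A S E} : S.lookup o = some (Ao, Bo) → CxTyV k Γ T Δ v Ao →
      CxTyC k Γ T (Bo :: Δ) c (.mk A S E) → CxTyC k Γ T Δ (.op o v c) (.mk A S E)
  | bind {k Γ T Δ c₁ c₂ A B S E} : CxTyC k Γ T Δ c₁ (.mk A S E) →
      CxTyC k Γ T (A :: Δ) c₂ (.mk B S E) → CxTyC k Γ T Δ (.bind c₁ c₂) (.mk B S E)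
  | handle {k Γ T Δ v c C D} : CxTyV k Γ T Δ v (.handler C D) → CxTyC k Γ T Δ c C →
      CxTyC k Γ T Δ (.handle v c) D
  | conv {k Γ T Δ c C C'} : CxTyC k Γ T Δ c C → CTyEq C C' → WfC C' → CxTyC k Γ T Δ c C'
inductive CxTyH : (k : Kind) → (Γ : Ctx) → (T : Ty k) → Ctx → HCx k → Sig → CTy → Prop
  | mk {k Γ T Δ h S D} : WfCtx Δ → WfSig S → WfC D → h.ops.Nodup →
      (∀ o, h.lookup o = none ↔ S.lookup o = none) →
      (∀ o A B co, S.lookup o = some (A, B) → h.lookup o = some co →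
        CxTyC k Γ T (.fn B D :: A :: Δ) co D) →
      CxTyH k Γ T Δ h S D
end

/-- The type `bool ! ∅ / ∅`. -/
abbrev groundTy : CTy := .mk .bool .nil .nil

/-- Ground computation contexts for `Γ` and `T`: closed computation contexts of type
`bool ! ∅ / ∅` with holes of type `T` in context `Γ`. -/
def GroundCx (k : Kind) (Γ : Ctx) (T : Ty k) (K : CCx k) : Prop :=
  CxTyC k Γ T [] K groundTy

/-- Contextual equivalence of two terms of type `T` in context `Γ`. -/
def CtxEquiv (k : Kind) (Γ : Ctx) (t t' : Tm k) (T : Ty k) : Prop :=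
  HasTy k Γ t T ∧ HasTy k Γ t' T ∧
    ∀ K : CCx k, GroundCx k Γ T K →
      (Steps (K.plug t) (.ret .tt) ↔ Steps (K.plug t') (.ret .tt))

end LocalEff

namespace LocalEff

/-! ### Substitution calculus -/

/-- The environment that extends `σ` by `v` at index `0`. -/
def scons (v : Val) (σ : ℕ → Val) : ℕ → Val
  | 0 => v
  | n + 1 => σ n

@[simp] theorem scons_zero (v : Val) (σ : ℕ → Val) : scons v σ 0 = v := rfl
@[simp] theorem scons_succ (v : Val) (σ : ℕ → Val) (n : ℕ) : scons v σ (n + 1) = σ n := rfl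
@[simp] theorem liftSub_zero (σ : ℕ → Val) : liftSub σ 0 = .var 0 := rfl
@[simp] theorem liftSub_succ (σ : ℕ → Val) (n : ℕ) : liftSub σ (n + 1) = (σ n).shift := rfl
@[simp] theorem liftRen_zero (ρ : ℕ → ℕ) : liftRen ρ 0 = 0 := rfl
@[simp] theorem liftRen_succ (ρ : ℕ → ℕ) (n : ℕ) : liftRen ρ (n + 1) = ρ n + 1 := rfl

theorem one_eq_scons (v : Val) : one v = scons v .var := by
  funext n; cases n <;> rfl

theorem two_eq_scons (v w : Val) : two v w = scons w (scons v .var) := by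
  funext n; rcases n with _ | _ | n <;> rfl

theorem liftSub_var_comp (ρ : ℕ → ℕ) :
    liftSub (fun n => .var (ρ n)) = fun n => .var (liftRen ρ n) := by
  funext n; cases n <;> simp [Val.shift, Val.rename]

mutual
theorem Val.rename_eq_subst : ∀ (v : Val) (ρ : ℕ → ℕ), v.rename ρ = v.subst (fun n => .var (ρ n))
  | .var _, _ | .unit, _ | .tt, _ | .ff, _ => rfl
  | .fn c, ρ => by simp [Val.rename, Val.subst, liftSub_var_comp, c.rename_eq_subst]
  | .handler cr h, ρ => by
      simp [Val.rename, Val.subst, liftSub_var_comp, cr.rename_eq_subst, h.rename_eq_subst]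
theorem Comp.rename_eq_subst :
    ∀ (c : Comp) (ρ : ℕ → ℕ), c.rename ρ = c.subst (fun n => .var (ρ n))
  | .ite v c₁ c₂, ρ => by
      simp [Comp.rename, Comp.subst, v.rename_eq_subst, c₁.rename_eq_subst, c₂.rename_eq_subst]
  | .app v w, ρ => by simp [Comp.rename, Comp.subst, v.rename_eq_subst, w.rename_eq_subst]
  | .ret v, ρ => by simp [Comp.rename, Comp.subst, v.rename_eq_subst]
  | .op o v c, ρ => by
      simp [Comp.rename, Comp.subst, liftSub_var_comp, v.rename_eq_subst, c.rename_eq_subst]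
  | .bind c₁ c₂, ρ => by
      simp [Comp.rename, Comp.subst, liftSub_var_comp, c₁.rename_eq_subst, c₂.rename_eq_subst]
  | .handle v c, ρ => by simp [Comp.rename, Comp.subst, v.rename_eq_subst, c.rename_eq_subst]
theorem Clauses.rename_eq_subst :
    ∀ (h : Clauses) (ρ : ℕ → ℕ), h.rename ρ = h.subst (fun n => .var (ρ n))
  | .nil, _ => rfl
  | .cons o c h, ρ => by
      simp [Clauses.rename, Clauses.subst, liftSub_var_comp, c.rename_eq_subst, h.rename_eq_subst]
end

theorem liftSub_comp_liftRen (ρ : ℕ → ℕ) (σ : ℕ → Val) :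
    (fun n => liftSub σ (liftRen ρ n)) = liftSub (fun n => σ (ρ n)) := by
  funext n; cases n <;> rfl

mutual
theorem Val.rename_subst : ∀ (v : Val) (ρ : ℕ → ℕ) (σ : ℕ → Val),
    (v.rename ρ).subst σ = v.subst (fun n => σ (ρ n))
  | .var _, _, _ | .unit, _, _ | .tt, _, _ | .ff, _, _ => rfl
  | .fn c, ρ, σ => by simp [Val.rename, Val.subst, c.rename_subst, liftSub_comp_liftRen]
  | .handler cr h, ρ, σ => by
      simp [Val.rename, Val.subst, cr.rename_subst, h.rename_subst, liftSub_comp_liftRen]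
theorem Comp.rename_subst : ∀ (c : Comp) (ρ : ℕ → ℕ) (σ : ℕ → Val),
    (c.rename ρ).subst σ = c.subst (fun n => σ (ρ n))
  | .ite v c₁ c₂, ρ, σ => by
      simp [Comp.rename, Comp.subst, v.rename_subst, c₁.rename_subst, c₂.rename_subst]
  | .app v w, ρ, σ => by simp [Comp.rename, Comp.subst, v.rename_subst, w.rename_subst]
  | .ret v, ρ, σ => by simp [Comp.rename, Comp.subst, v.rename_subst]
  | .op o v c, ρ, σ => by
      simp [Comp.rename, Comp.subst, v.rename_subst, c.rename_subst, liftSub_comp_liftRen]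
  | .bind c₁ c₂, ρ, σ => by
      simp [Comp.rename, Comp.subst, c₁.rename_subst, c₂.rename_subst, liftSub_comp_liftRen]
  | .handle v c, ρ, σ => by simp [Comp.rename, Comp.subst, v.rename_subst, c.rename_subst]
theorem Clauses.rename_subst : ∀ (h : Clauses) (ρ : ℕ → ℕ) (σ : ℕ → Val),
    (h.rename ρ).subst σ = h.subst (fun n => σ (ρ n))
  | .nil, _, _ => rfl
  | .cons o c h, ρ, σ => by
      simp [Clauses.rename, Clauses.subst, c.rename_subst, h.rename_subst, liftSub_comp_liftRen]
end

theorem Val.rename_rename (v : Val) (ρ ρ' : ℕ → ℕ) :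
    (v.rename ρ).rename ρ' = v.rename (fun n => ρ' (ρ n)) := by
  rw [Val.rename_eq_subst _ ρ', Val.rename_subst, Val.rename_eq_subst]

theorem liftSub_rename (σ : ℕ → Val) (ρ : ℕ → ℕ) :
    (fun n => (liftSub σ n).rename (liftRen ρ)) = liftSub (fun n => (σ n).rename ρ) := by
  funext n; cases n <;> simp [Val.shift, Val.rename, Val.rename_rename]

mutual
theorem Val.subst_rename : ∀ (v : Val) (σ : ℕ → Val) (ρ : ℕ → ℕ),
    (v.subst σ).rename ρ = v.subst (fun n => (σ n).rename ρ)
  | .var _, _, _ | .unit, _, _ | .tt, _, _ | .ff, _, _ => rfl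
  | .fn c, σ, ρ => by simp [Val.rename, Val.subst, c.subst_rename, liftSub_rename]
  | .handler cr h, σ, ρ => by
      simp [Val.rename, Val.subst, cr.subst_rename, h.subst_rename, liftSub_rename]
theorem Comp.subst_rename : ∀ (c : Comp) (σ : ℕ → Val) (ρ : ℕ → ℕ),
    (c.subst σ).rename ρ = c.subst (fun n => (σ n).rename ρ)
  | .ite v c₁ c₂, σ, ρ => by
      simp [Comp.rename, Comp.subst, v.subst_rename, c₁.subst_rename, c₂.subst_rename]
  | .app v w, σ, ρ => by simp [Comp.rename, Comp.subst, v.subst_rename, w.subst_rename]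
  | .ret v, σ, ρ => by simp [Comp.rename, Comp.subst, v.subst_rename]
  | .op o v c, σ, ρ => by
      simp [Comp.rename, Comp.subst, v.subst_rename, c.subst_rename, liftSub_rename]
  | .bind c₁ c₂, σ, ρ => by
      simp [Comp.rename, Comp.subst, c₁.subst_rename, c₂.subst_rename, liftSub_rename]
  | .handle v c, σ, ρ => by simp [Comp.rename, Comp.subst, v.subst_rename, c.subst_rename]
theorem Clauses.subst_rename : ∀ (h : Clauses) (σ : ℕ → Val) (ρ : ℕ → ℕ),
    (h.subst σ).rename ρ = h.subst (fun n => (σ n).rename ρ)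
  | .nil, _, _ => rfl
  | .cons o c h, σ, ρ => by
      simp [Clauses.rename, Clauses.subst, c.subst_rename, h.subst_rename, liftSub_rename]
end

theorem liftSub_subst (σ τ : ℕ → Val) :
    (fun n => (liftSub σ n).subst (liftSub τ)) = liftSub (fun n => (σ n).subst τ) := by
  funext n; cases n <;> simp [Val.shift, Val.subst, Val.rename_subst, Val.subst_rename]

mutual
theorem Val.subst_subst : ∀ (v : Val) (σ τ : ℕ → Val),
    (v.subst σ).subst τ = v.subst (fun n => (σ n).subst τ)
  | .var _, _, _ | .unit, _, _ | .tt, _, _ | .ff, _, _ => rfl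
  | .fn c, σ, τ => by simp [Val.subst, c.subst_subst, liftSub_subst]
  | .handler cr h, σ, τ => by simp [Val.subst, cr.subst_subst, h.subst_subst, liftSub_subst]
theorem Comp.subst_subst : ∀ (c : Comp) (σ τ : ℕ → Val),
    (c.subst σ).subst τ = c.subst (fun n => (σ n).subst τ)
  | .ite v c₁ c₂, σ, τ => by simp [Comp.subst, v.subst_subst, c₁.subst_subst, c₂.subst_subst]
  | .app v w, σ, τ => by simp [Comp.subst, v.subst_subst, w.subst_subst]
  | .ret v, σ, τ => by simp [Comp.subst, v.subst_subst]
  | .op o v c, σ, τ => by simp [Comp.subst, v.subst_subst, c.subst_subst, liftSub_subst]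
  | .bind c₁ c₂, σ, τ => by simp [Comp.subst, c₁.subst_subst, c₂.subst_subst, liftSub_subst]
  | .handle v c, σ, τ => by simp [Comp.subst, v.subst_subst, c.subst_subst]
theorem Clauses.subst_subst : ∀ (h : Clauses) (σ τ : ℕ → Val),
    (h.subst σ).subst τ = h.subst (fun n => (σ n).subst τ)
  | .nil, _, _ => rfl
  | .cons o c h, σ, τ => by simp [Clauses.subst, c.subst_subst, h.subst_subst, liftSub_subst]
end

theorem liftSub_var : liftSub .var = .var := by
  funext n; cases n <;> rfl

mutual
theorem Val.subst_var : ∀ v : Val, v.subst .var = v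
  | .var _ | .unit | .tt | .ff => rfl
  | .fn c => by simp [Val.subst, liftSub_var, c.subst_var]
  | .handler cr h => by simp [Val.subst, liftSub_var, cr.subst_var, h.subst_var]
theorem Comp.subst_var : ∀ c : Comp, c.subst .var = c
  | .ite v c₁ c₂ => by simp [Comp.subst, v.subst_var, c₁.subst_var, c₂.subst_var]
  | .app v w => by simp [Comp.subst, v.subst_var, w.subst_var]
  | .ret v => by simp [Comp.subst, v.subst_var]
  | .op o v c => by simp [Comp.subst, liftSub_var, v.subst_var, c.subst_var]
  | .bind c₁ c₂ => by simp [Comp.subst, liftSub_var, c₁.subst_var, c₂.subst_var]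
  | .handle v c => by simp [Comp.subst, v.subst_var, c.subst_var]
theorem Clauses.subst_var : ∀ h : Clauses, h.subst .var = h
  | .nil => rfl
  | .cons o c h => by simp [Clauses.subst, liftSub_var, c.subst_var, h.subst_var]
end

@[simp] theorem Val.shift_subst_scons (v u : Val) (σ : ℕ → Val) :
    (v.rename Nat.succ).subst (scons u σ) = v.subst σ := by
  rw [Val.rename_subst]; rfl

@[simp] theorem Clauses.shift_subst_scons (h : Clauses) (u : Val) (σ : ℕ → Val) :
    (h.rename Nat.succ).subst (scons u σ) = h.subst σ := by
  rw [Clauses.rename_subst]; rfl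

theorem liftSub_subst_scons (σ τ : ℕ → Val) (u : Val) :
    (fun n => (liftSub σ n).subst (scons u τ)) = scons u (fun n => (σ n).subst τ) := by
  funext n; cases n <;> simp [Val.subst]

theorem liftSub_subst_one (σ : ℕ → Val) (u : Val) :
    (fun n => (liftSub σ n).subst (one u)) = scons u σ := by
  rw [one_eq_scons, liftSub_subst_scons]; simp only [Val.subst_var]

theorem one_subst (u : Val) (σ : ℕ → Val) :
    (fun n => (one u n).subst σ) = scons (u.subst σ) σ := by
  funext n; cases n <;> rfl

theorem two_subst (u v : Val) (σ : ℕ → Val) :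
    (fun n => (two u v n).subst σ) = scons (v.subst σ) (scons (u.subst σ) σ) := by
  funext n; rcases n with _ | _ | n <;> rfl

theorem liftSub_subst_two (σ : ℕ → Val) (u v : Val) :
    (fun n => (liftSub (liftSub σ) n).subst (two u v)) = scons v (scons u σ) := by
  rw [two_eq_scons, liftSub_subst_scons, liftSub_subst_scons]; simp only [Val.subst_var]

theorem Comp.liftSub_subst_one (c : Comp) (σ : ℕ → Val) (u : Val) :
    (c.subst (liftSub σ)).subst (one u) = c.subst (scons u σ) := by
  rw [Comp.subst_subst, LocalEff.liftSub_subst_one]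

theorem Comp.liftSub_subst_two (c : Comp) (σ : ℕ → Val) (u v : Val) :
    (c.subst (liftSub (liftSub σ))).subst (two u v) = c.subst (scons v (scons u σ)) := by
  rw [Comp.subst_subst, LocalEff.liftSub_subst_two]

@[simp] theorem Val.shift_subst_one (v u : Val) : (v.rename Nat.succ).subst (one u) = v := by
  rw [one_eq_scons, Val.shift_subst_scons, Val.subst_var]

@[simp] theorem Clauses.shift_subst_one (h : Clauses) (u : Val) :
    (h.rename Nat.succ).subst (one u) = h := by
  rw [one_eq_scons, Clauses.shift_subst_scons, Clauses.subst_var]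

theorem Comp.liftRen_succ_subst_liftSub_one (c : Comp) (u : Val) :
    (c.rename (liftRen Nat.succ)).subst (liftSub (one u)) = c := by
  rw [Comp.rename_subst, liftSub_comp_liftRen]
  exact (congrArg c.subst liftSub_var).trans c.subst_var

theorem Clauses.lookup_subst (h : Clauses) (σ : ℕ → Val) (o : ℕ) :
    (h.subst σ).lookup o = (h.lookup o).map (fun c => c.subst (liftSub (liftSub σ))) := by
  induction h using Clauses.rec (motive_1 := fun _ => True) (motive_2 := fun _ => True) with
  | nil => rfl
  | cons o' c h _ ih => simp only [Clauses.subst, Clauses.lookup]; split <;> simp [ih]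
  | _ => trivial

theorem Clauses.ops_subst (h : Clauses) (σ : ℕ → Val) : (h.subst σ).ops = h.ops := by
  induction h using Clauses.rec (motive_1 := fun _ => True) (motive_2 := fun _ => True) with
  | nil => rfl
  | cons o' c h _ ih => simp [Clauses.subst, Clauses.ops, ih]
  | _ => trivial

theorem Tmpl.inst_subst (T : Tmpl) : ∀ (f σ τ : ℕ → Val),
    (T.inst f σ).subst τ = T.inst (fun j => (f j).subst τ) (fun i => (σ i).subst τ) := by
  induction T with
  | app z v => intro f σ τ; simp [Tmpl.inst, Comp.subst, Val.subst_subst]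
  | ite v T₁ T₂ ih₁ ih₂ => intro f σ τ; simp [Tmpl.inst, Comp.subst, Val.subst_subst, ih₁, ih₂]
  | op o v T ih =>
      intro f σ τ
      simp [Tmpl.inst, Comp.subst, Val.subst_subst, ih, liftSub_subst, Val.rename_subst,
        Val.subst_rename]

theorem Tmpl.handled_subst (T : Tmpl) : ∀ (h : Clauses) (f σ τ : ℕ → Val),
    (T.handled h f σ).subst τ =
      T.handled (h.subst τ) (fun j => (f j).subst τ) (fun i => (σ i).subst τ) := by
  induction T with
  | app z v => intro h f σ τ; simp [Tmpl.handled, Comp.subst, Val.subst_subst]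
  | ite v T₁ T₂ ih₁ ih₂ =>
      intro h f σ τ; simp [Tmpl.handled, Comp.subst, Val.subst_subst, ih₁, ih₂]
  | op o v T ih =>
      intro h f σ τ
      simp only [Tmpl.handled, Clauses.lookup_subst]
      cases h.lookup o <;>
        simp [Comp.subst, Val.subst, Val.subst_subst, ih, liftSub_subst, Val.rename_subst,
          Val.subst_rename, Clauses.rename_subst, Clauses.subst_rename, Comp.subst_subst, two_subst,
          liftSub_subst_two]

theorem Tmpl.inst_lift_subst_one (T : Tmpl) (f σ : ℕ → Val) (u : Val) :
    (T.inst (fun j => (f j).shift) (liftSub σ)).subst (one u) = T.inst f (scons u σ) := by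
  simp [Tmpl.inst_subst, liftSub_subst_one]

theorem Tmpl.handled_lift_subst_one (T : Tmpl) (h : Clauses) (f σ : ℕ → Val) (u : Val) :
    (T.handled (h.rename Nat.succ) (fun j => (f j).shift) (liftSub σ)).subst (one u) =
      T.handled h f (scons u σ) := by
  simp [Tmpl.handled_subst, liftSub_subst_one]

/-! ### Well-formedness of the types in a typing judgement -/

theorem WfCtx.get : ∀ {Γ : Ctx} {n : ℕ} {A : VTy}, WfCtx Γ → Γ[n]? = some A → WfV A
  | _ :: _, 0, _, .cons _ hA, e => by simp at e; exact e ▸ hA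
  | _ :: _, n + 1, _, .cons hΓ _, e => by simp at e; exact hΓ.get e

theorem WfCtx.append : ∀ {X Γ : Ctx}, WfCtx X → WfCtx Γ → WfCtx (X ++ Γ)
  | [], _, _, h => h
  | _ :: _, _, .cons h hA, h' => .cons (h.append h') hA

theorem WfCtx.map_fn {D : CTy} (hD : WfC D) :
    ∀ {Z : Ctx}, WfCtx Z → WfCtx (Z.map (fun B => VTy.fn B D))
  | [], _ => .nil
  | _ :: _, .cons h hA => .cons (h.map_fn hD) (.fn hA hD)

theorem WfSig.get : ∀ {S : Sig} {o : ℕ} {A B : VTy}, WfSig S → S.lookup o = some (A, B) →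
    WfV A ∧ WfV B
  | .cons o' A' B' S, o, A, B, .cons hS hA hB _, e => by
      simp only [Sig.lookup] at e
      split at e
      · cases e; exact ⟨hA, hB⟩
      · exact hS.get e

theorem WfTheory.wfSig : ∀ {S : Sig} {E : Theory}, WfTheory S E → WfSig S
  | _, _, .nil h => h
  | _, _, .cons h _ _ _ _ => h.wfSig

theorem WfTheory.wfT {X Z : Ctx} {T₁ T₂ : Tmpl} : ∀ {S : Sig} {E : Theory}, WfTheory S E →
    E.Mem X Z T₁ T₂ → WfT X Z T₁ S ∧ WfT X Z T₂ S
  | _, _, .cons h _ _ h₁ h₂, e => by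
      rcases e with ⟨rfl, rfl, rfl, rfl⟩ | e
      · exact ⟨h₁, h₂⟩
      · exact h.wfT e

theorem HasTyH.wf {Γ h S D} : HasTyH Γ h S D → WfCtx Γ ∧ WfSig S ∧ WfC D
  | .mk h₁ h₂ h₃ _ _ _ => ⟨h₁, h₂, h₃⟩

theorem Respects.hasTyH : ∀ {Γ h E S D}, Respects Γ h E S D → HasTyH Γ h S D
  | _, _, _, _, _, .nil h => h
  | _, _, _, _, _, .cons h _ _ => h.hasTyH

theorem Respects.wfTheory {Γ h E S D} : Respects Γ h E S D → WfTheory S E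
  | .nil h => .nil h.wf.2.1
  | .cons _ h _ => h

mutual
theorem HasTyV.wf : ∀ {Γ v A}, HasTyV Γ v A → WfCtx Γ ∧ WfV A
  | _, _, _, .var h e => ⟨h, h.get e⟩
  | _, _, _, .unit h => ⟨h, .unit⟩
  | _, _, _, .tt h => ⟨h, .bool⟩
  | _, _, _, .ff h => ⟨h, .bool⟩
  | _, _, _, .fn h => by
      obtain ⟨h₁, h₂⟩ := h.wf
      cases h₁ with | cons a b => exact ⟨a, .fn b h₂⟩
  | _, _, _, .handler h₁ h₂ => by
      obtain ⟨h₃, h₄⟩ := h₁.wf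
      cases h₃ with | cons a b => exact ⟨a, .handler (.mk b h₂.wfTheory.wfSig h₂.wfTheory) h₄⟩
  | _, _, _, .conv h _ h' => ⟨h.wf.1, h'⟩
theorem HasTyC.wf : ∀ {Γ c C}, HasTyC Γ c C → WfCtx Γ ∧ WfC C
  | _, _, _, .ite _ h _ => h.wf
  | _, _, _, .app h _ => by
      obtain ⟨h₁, h₂⟩ := h.wf
      cases h₂ with | fn a b => exact ⟨h₁, b⟩
  | _, _, _, .ret h h' => ⟨h.wf.1, h'⟩
  | _, _, _, .op _ h h' => ⟨h.wf.1, h'.wf.2⟩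
  | _, _, _, .bind h h' => ⟨h.wf.1, h'.wf.2⟩
  | _, _, _, .handle h _ => by
      obtain ⟨h₁, h₂⟩ := h.wf
      cases h₂ with | handler a b => exact ⟨h₁, b⟩
  | _, _, _, .conv h _ h' => ⟨h.wf.1, h'⟩
end

theorem WfCtx.of_cons {A : VTy} {Γ : Ctx} : WfCtx (A :: Γ) → WfCtx Γ ∧ WfV A
  | .cons h h' => ⟨h, h'⟩

/-! ### Well-typed terms depend only on the variables of their context -/

theorem liftSub_congr {σ τ : ℕ → Val} {n : ℕ} (h : ∀ i < n, σ i = τ i) :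
    ∀ i < n + 1, liftSub σ i = liftSub τ i := by
  intro i hi
  rcases i with _ | i
  · rfl
  · simp [h i (by omega)]

theorem Clauses.mem_ops_of_lookup : ∀ {h : Clauses} {o : ℕ} {co : Comp}, h.lookup o = some co →
    o ∈ h.ops
  | .cons o' c h, o, co, e => by
      simp only [Clauses.lookup] at e
      split at e
      · simp [Clauses.ops, *]
      · simp [Clauses.ops, mem_ops_of_lookup e]

/-- Clauses without repetitions are determined by their operations and by lookup. -/
theorem Clauses.subst_congr {σ τ : ℕ → Val} : ∀ {h : Clauses}, h.ops.Nodup →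
    (∀ o co, h.lookup o = some co →
      co.subst (liftSub (liftSub σ)) = co.subst (liftSub (liftSub τ))) →
    h.subst σ = h.subst τ
  | .nil, _, _ => rfl
  | .cons o c h, nd, e => by
      simp only [Clauses.ops, List.nodup_cons] at nd
      have h₁ := e o c (by simp [Clauses.lookup])
      have h₂ := Clauses.subst_congr (h := h) nd.2 (σ := σ) (τ := τ) (fun o' co ho' => by
        refine e o' co ?_
        have : o' ≠ o := by
          rintro rfl
          exact nd.1 (Clauses.mem_ops_of_lookup ho')
        simp [Clauses.lookup, this, ho'])
      simp [Clauses.subst, h₁, h₂]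

mutual
theorem HasTyV.subst_congr : ∀ {Γ v A}, HasTyV Γ v A → ∀ {σ τ : ℕ → Val},
    (∀ i < Γ.length, σ i = τ i) → v.subst σ = v.subst τ
  | _, _, _, .var _ e, _, _, hst => by
      simp only [Val.subst]
      exact hst _ (List.getElem?_eq_some_iff.1 e).1
  | _, _, _, .unit _, _, _, _ => rfl
  | _, _, _, .tt _, _, _, _ => rfl
  | _, _, _, .ff _, _, _, _ => rfl
  | _, _, _, .fn h, _, _, hst => by
      simp only [Val.subst]
      rw [h.subst_congr (liftSub_congr hst)]
  | _, _, _, .handler h₁ h₂, _, _, hst => by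
      simp only [Val.subst]
      rw [h₁.subst_congr (liftSub_congr hst), h₂.subst_congr hst]
  | _, _, _, .conv h _ _, _, _, hst => h.subst_congr hst
theorem HasTyC.subst_congr : ∀ {Γ c C}, HasTyC Γ c C → ∀ {σ τ : ℕ → Val},
    (∀ i < Γ.length, σ i = τ i) → c.subst σ = c.subst τ
  | _, _, _, .ite h₁ h₂ h₃, _, _, hst => by
      simp only [Comp.subst]
      rw [h₁.subst_congr hst, h₂.subst_congr hst, h₃.subst_congr hst]
  | _, _, _, .app h₁ h₂, _, _, hst => by
      simp only [Comp.subst]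
      rw [h₁.subst_congr hst, h₂.subst_congr hst]
  | _, _, _, .ret h _, _, _, hst => by
      simp only [Comp.subst]
      rw [h.subst_congr hst]
  | _, _, _, .op _ h₁ h₂, _, _, hst => by
      simp only [Comp.subst]
      rw [h₁.subst_congr hst, h₂.subst_congr (liftSub_congr hst)]
  | _, _, _, .bind h₁ h₂, _, _, hst => by
      simp only [Comp.subst]
      rw [h₁.subst_congr hst, h₂.subst_congr (liftSub_congr hst)]
  | _, _, _, .handle h₁ h₂, _, _, hst => by
      simp only [Comp.subst]
      rw [h₁.subst_congr hst, h₂.subst_congr hst]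
  | _, _, _, .conv h _ _, _, _, hst => h.subst_congr hst
theorem HasTyH.subst_congr : ∀ {Γ h S D}, HasTyH Γ h S D → ∀ {σ τ : ℕ → Val},
    (∀ i < Γ.length, σ i = τ i) → h.subst σ = h.subst τ
  | _, h, S, _, .mk _ _ _ hnd hl hc, _, _, hst => by
      refine Clauses.subst_congr hnd fun o co ho => ?_
      obtain ⟨⟨A, B⟩, hS⟩ : ∃ p, S.lookup o = some p := by
        rw [← Option.ne_none_iff_exists']
        intro hS
        rw [(hl o).2 hS] at ho
        cases ho
      exact (hc o A B co hS ho).subst_congr (liftSub_congr (liftSub_congr hst))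
theorem Respects.subst_congr : ∀ {Γ h E S D}, Respects Γ h E S D → ∀ {σ τ : ℕ → Val},
    (∀ i < Γ.length, σ i = τ i) → h.subst σ = h.subst τ
  | _, _, _, _, _, .nil h, _, _, hst => h.subst_congr hst
  | _, _, _, _, _, .cons h _ _, _, _, hst => h.subst_congr hst
end

theorem WfT.handled_congr : ∀ {X Z T S}, WfT X Z T S → ∀ (h : Clauses) {f g σ τ : ℕ → Val},
    (∀ j < Z.length, f j = g j) → (∀ i < X.length, σ i = τ i) →
    T.handled h f σ = T.handled h g τ
  | _, _, _, _, .app _ _ hv hz, h, _, _, _, _, hf, hs => by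
      simp only [Tmpl.handled]
      rw [hv.subst_congr hs, hf _ (List.getElem?_eq_some_iff.1 hz).1]
  | _, _, _, _, .ite hv h₁ h₂, h, _, _, _, _, hf, hs => by
      simp only [Tmpl.handled]
      rw [hv.subst_congr hs, h₁.handled_congr h hf hs, h₂.handled_congr h hf hs]
  | _, _, _, _, .op _ hv hT, h, f, g, _, _, hf, hs => by
      simp only [Tmpl.handled]
      rw [hv.subst_congr hs, hT.handled_congr (h.rename Nat.succ)
        (f := fun j => (f j).shift) (g := fun j => (g j).shift)
        (fun j hj => by rw [hf j hj]) (liftSub_congr hs)]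

/-! ### Substitution preserves typing -/

theorem Val.rename_id (v : Val) : v.rename (fun n => n) = v := by
  rw [Val.rename_eq_subst, Val.subst_var]

/-- Substitutions that are well-typed after any weakening. -/
def StableSub (Γ Δ : Ctx) (σ : ℕ → Val) : Prop :=
  ∀ Ξ : Ctx, WfCtx (Ξ ++ Δ) → ∀ (i : ℕ) (B : VTy), Γ[i]? = some B →
    HasTyV (Ξ ++ Δ) ((σ i).rename (· + Ξ.length)) B

theorem StableSub.hasTyV {Γ Δ : Ctx} {σ : ℕ → Val} (h : StableSub Γ Δ σ) (hΔ : WfCtx Δ)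
    {i : ℕ} {B : VTy} (e : Γ[i]? = some B) : HasTyV Δ (σ i) B := by
  have := h [] hΔ i B e
  simpa [Val.rename_id] using this

theorem StableSub.lift {Γ Δ : Ctx} {σ : ℕ → Val} (h : StableSub Γ Δ σ) (A : VTy) :
    StableSub (A :: Γ) (A :: Δ) (liftSub σ) := by
  intro Ξ hΞ i B e
  rcases i with _ | i
  · simp at e
    subst e
    exact .var hΞ (by simp)
  · simp at e
    have := h (Ξ ++ [A]) (by simpa using hΞ) i B e
    simp only [List.append_assoc, List.singleton_append, List.length_append,
      List.length_singleton] at this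
    simpa [Val.rename_rename, Nat.add_assoc, Nat.add_comm 1] using this

/-- Lifting of a substitution under `n` binders. -/
def liftSubN (n : ℕ) (σ : ℕ → Val) (i : ℕ) : Val :=
  if i < n then .var i else (σ (i - n)).rename (· + n)

theorem StableSub.liftSubN_hasTyV {Γ Δ Ξ : Ctx} {σ : ℕ → Val} (h : StableSub Γ Δ σ)
    (hΞ : WfCtx (Ξ ++ Δ)) (i : ℕ) (B : VTy) (e : (Ξ ++ Γ)[i]? = some B) :
    HasTyV (Ξ ++ Δ) (liftSubN Ξ.length σ i) B := by
  unfold liftSubN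
  split
  · rename_i hi
    refine .var hΞ ?_
    rwa [List.getElem?_append_left hi] at e ⊢
  · rename_i hi
    rw [List.getElem?_append_right (by omega)] at e
    exact h Ξ hΞ _ _ e

theorem WfT.handled_liftSubN {X Z T S} (hT : WfT X Z T S) (h : Clauses) (σ : ℕ → Val) :
    (T.handled (h.rename (· + (X.length + Z.length))) (fun j => .var j)
      (fun i => .var (i + Z.length))).subst (liftSubN (X.length + Z.length) σ) =
    T.handled ((h.subst σ).rename (· + (X.length + Z.length))) (fun j => .var j)
      (fun i => .var (i + Z.length)) := by
  rw [Tmpl.handled_subst, Clauses.rename_subst, Clauses.subst_rename]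
  simp only [liftSubN, Nat.add_sub_cancel, Nat.not_lt.2 (Nat.le_add_left _ _), if_false]
  refine hT.handled_congr _ (fun j hj => ?_) (fun i hi => ?_)
  · simp only [Val.subst, liftSubN]; rw [if_pos (by omega)]
  · simp only [Val.subst, liftSubN]; rw [if_pos (by omega)]

theorem Clauses.lookup_subst_eq_some {h : Clauses} {σ : ℕ → Val} {o : ℕ} {co : Comp}
    (e : (h.subst σ).lookup o = some co) :
    ∃ co', h.lookup o = some co' ∧ co = co'.subst (liftSub (liftSub σ)) := by
  rw [Clauses.lookup_subst, Option.map_eq_some_iff] at e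
  obtain ⟨co', e, rfl⟩ := e
  exact ⟨co', e, rfl⟩

mutual
theorem HasTyV.subst_stable : ∀ {Γ v A}, HasTyV Γ v A → ∀ {Δ : Ctx} {σ : ℕ → Val}, WfCtx Δ →
    StableSub Γ Δ σ → HasTyV Δ (v.subst σ) A
  | _, _, _, .var _ e, _, _, hΔ, hs => hs.hasTyV hΔ e
  | _, _, _, .unit _, _, _, hΔ, _ => .unit hΔ
  | _, _, _, .tt _, _, _, hΔ, _ => .tt hΔ
  | _, _, _, .ff _, _, _, hΔ, _ => .ff hΔ
  | _, _, _, .fn h, _, _, hΔ, hs => .fn (h.subst_stable (.cons hΔ h.wf.1.of_cons.2) (hs.lift _))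
  | _, _, _, .handler h₁ h₂, _, _, hΔ, hs =>
      .handler (h₁.subst_stable (.cons hΔ h₁.wf.1.of_cons.2) (hs.lift _))
        (h₂.subst_stable hΔ hs)
  | _, _, _, .conv h e h', _, _, hΔ, hs => .conv (h.subst_stable hΔ hs) e h'
termination_by structural _ _ _ h => h
theorem HasTyC.subst_stable : ∀ {Γ c C}, HasTyC Γ c C → ∀ {Δ : Ctx} {σ : ℕ → Val}, WfCtx Δ →
    StableSub Γ Δ σ → HasTyC Δ (c.subst σ) C
  | _, _, _, .ite h₁ h₂ h₃, _, _, hΔ, hs =>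
      .ite (h₁.subst_stable hΔ hs) (h₂.subst_stable hΔ hs) (h₃.subst_stable hΔ hs)
  | _, _, _, .app h₁ h₂, _, _, hΔ, hs => .app (h₁.subst_stable hΔ hs) (h₂.subst_stable hΔ hs)
  | _, _, _, .ret h h', _, _, hΔ, hs => .ret (h.subst_stable hΔ hs) h'
  | _, _, _, .op e h₁ h₂, _, _, hΔ, hs =>
      .op e (h₁.subst_stable hΔ hs)
        (h₂.subst_stable (.cons hΔ h₂.wf.1.of_cons.2) (hs.lift _))
  | _, _, _, .bind h₁ h₂, _, _, hΔ, hs =>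
      .bind (h₁.subst_stable hΔ hs) (h₂.subst_stable (.cons hΔ h₂.wf.1.of_cons.2) (hs.lift _))
  | _, _, _, .handle h₁ h₂, _, _, hΔ, hs =>
      .handle (h₁.subst_stable hΔ hs) (h₂.subst_stable hΔ hs)
  | _, _, _, .conv h e h', _, _, hΔ, hs => .conv (h.subst_stable hΔ hs) e h'
termination_by structural _ _ _ h => h
theorem HasTyH.subst_stable : ∀ {Γ h S D}, HasTyH Γ h S D → ∀ {Δ : Ctx} {σ : ℕ → Val},
    WfCtx Δ → StableSub Γ Δ σ → HasTyH Δ (h.subst σ) S D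
  | _, h, _, _, .mk _ hS hD hnd hl hc, _, σ, hΔ, hs => by
      refine .mk hΔ hS hD (by rwa [Clauses.ops_subst])
        (fun o => by rw [Clauses.lookup_subst, Option.map_eq_none_iff, hl]) ?_
      intro o A B co ho hco
      obtain ⟨co', hco', rfl⟩ := Clauses.lookup_subst_eq_some hco
      obtain ⟨hA, hB⟩ := hS.get ho
      exact (hc o A B co' ho hco').subst_stable (.cons (.cons hΔ hA) (.fn hB hD))
        ((hs.lift _).lift _)
termination_by structural _ _ _ _ h => h
theorem Respects.subst_stable : ∀ {Γ h E S D}, Respects Γ h E S D →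
    ∀ {Δ : Ctx} {σ : ℕ → Val}, WfCtx Δ → StableSub Γ Δ σ → Respects Δ (h.subst σ) E S D
  | _, _, _, _, _, .nil h, _, _, hΔ, hs => .nil (h.subst_stable hΔ hs)
  | Γ, h, _, _, _, .cons (X := X) (Z := Z) (D := D) hR hT he, Δ, σ, hΔ, hs => by
      refine .cons (hR.subst_stable hΔ hs) hT ?_
      cases hT with
      | cons _ hX hZ hT₁ hT₂ =>
        have hΞ : WfCtx ((Z.map (fun B => VTy.fn B D) ++ X) ++ Δ) :=
          ((hZ.map_fn hR.hasTyH.wf.2.2).append hX).append hΔ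
        have := EqC.subst he (σ := liftSubN (X.length + Z.length) σ)
          (by simpa using hΞ) (fun i B e => by
            have := hs.liftSubN_hasTyV hΞ i B (by simpa using e)
            simpa [Nat.add_comm] using this)
        rwa [hT₁.handled_liftSubN, hT₂.handled_liftSubN] at this
termination_by structural _ _ _ _ _ h => h
end

theorem HasTyV.rename {Γ Δ : Ctx} {v : Val} {A : VTy} (h : HasTyV Γ v A) {ρ : ℕ → ℕ}
    (hΔ : WfCtx Δ) (hρ : ∀ i B, Γ[i]? = some B → Δ[ρ i]? = some B) : HasTyV Δ (v.rename ρ) A := by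
  rw [Val.rename_eq_subst]
  refine h.subst_stable hΔ fun Ξ hΞ i B e => .var hΞ ?_
  rw [List.getElem?_append_right (Nat.le_add_left _ _), Nat.add_sub_cancel]
  exact hρ i B e

theorem HasTyV.shift {Γ : Ctx} {v : Val} {A B : VTy} (h : HasTyV Γ v A) (hB : WfV B) :
    HasTyV (B :: Γ) v.shift A :=
  h.rename (.cons h.wf.1 hB) fun _ _ e => by simpa using e

theorem stableSub_of_hasTyV {Γ Δ : Ctx} {σ : ℕ → Val}
    (h : ∀ i B, Γ[i]? = some B → HasTyV Δ (σ i) B) : StableSub Γ Δ σ := by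
  intro Ξ hΞ i B e
  refine (h i B e).rename hΞ fun j C e => ?_
  rwa [List.getElem?_append_right (Nat.le_add_left _ _), Nat.add_sub_cancel]

theorem HasTyC.rename_bind {Γ : Ctx} {A B : VTy} {c : Comp} {C : CTy} (h : HasTyC (A :: Γ) c C)
    (hB : WfV B) : HasTyC (A :: B :: Γ) (c.rename (liftRen Nat.succ)) C := by
  rw [Comp.rename_eq_subst]
  obtain ⟨hΓ, hA⟩ := h.wf.1.of_cons
  have hΔ : WfCtx (A :: B :: Γ) := .cons (.cons hΓ hB) hA
  refine h.subst_stable hΔ (stableSub_of_hasTyV fun i B e => .var hΔ ?_)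
  rcases i with _ | i <;> simpa using e

theorem HasTyV.subst {Γ Δ : Ctx} {v : Val} {A : VTy} (h : HasTyV Γ v A) {σ : ℕ → Val}
    (hΔ : WfCtx Δ) (hs : ∀ i B, Γ[i]? = some B → HasTyV Δ (σ i) B) : HasTyV Δ (v.subst σ) A :=
  h.subst_stable hΔ (stableSub_of_hasTyV hs)

theorem HasTyC.subst {Γ Δ : Ctx} {c : Comp} {C : CTy} (h : HasTyC Γ c C) {σ : ℕ → Val}
    (hΔ : WfCtx Δ) (hs : ∀ i B, Γ[i]? = some B → HasTyV Δ (σ i) B) : HasTyC Δ (c.subst σ) C :=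
  h.subst_stable hΔ (stableSub_of_hasTyV hs)

theorem HasTyC.subst_one {Γ : Ctx} {A : VTy} {c : Comp} {C : CTy} {v : Val}
    (h : HasTyC (A :: Γ) c C) (hv : HasTyV Γ v A) : HasTyC Γ (c.subst (one v)) C := by
  refine h.subst hv.wf.1 fun i B e => ?_
  rcases i with _ | i
  · simp at e; exact e ▸ hv
  · exact .var hv.wf.1 (by simpa using e)

theorem HasTyC.subst_two {Γ : Ctx} {A B : VTy} {c : Comp} {C : CTy} {v w : Val}
    (h : HasTyC (B :: A :: Γ) c C) (hv : HasTyV Γ v A) (hw : HasTyV Γ w B) :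
    HasTyC Γ (c.subst (two v w)) C := by
  refine h.subst hv.wf.1 fun i B e => ?_
  rcases i with _ | _ | i
  · simp at e; exact e ▸ hw
  · simp at e; exact e ▸ hv
  · exact .var hv.wf.1 (by simpa using e)

/-! ### Both sides of a derivable equation are well-typed -/

theorem WfT.inst_hasTyC {A : VTy} {E : Theory} : ∀ {X Z T S}, WfT X Z T S →
    WfC (.mk A S E) → ∀ {Γ : Ctx} {f σ : ℕ → Val}, WfCtx Γ →
    (∀ i B, X[i]? = some B → HasTyV Γ (σ i) B) →
    (∀ j B, Z[j]? = some B → HasTyV Γ (f j) (.fn B (.mk A S E))) →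
    HasTyC Γ (T.inst f σ) (.mk A S E)
  | _, _, _, _, .app _ _ hv hz, _, _, _, _, hΓ, hs, hf => .app (hf _ _ hz) (hv.subst hΓ hs)
  | _, _, _, _, .ite hv h₁ h₂, hC, _, _, _, hΓ, hs, hf =>
      .ite (hv.subst hΓ hs) (h₁.inst_hasTyC hC hΓ hs hf) (h₂.inst_hasTyC hC hΓ hs hf)
  | _, _, _, _, .op (B := B) e hv hT, hC, _, _, _, hΓ, hs, hf => by
      have hB : WfV B := by
        cases hC with | mk _ hS _ => exact (hS.get e).2
      exact .op e (hv.subst hΓ hs) (hT.inst_hasTyC hC (.cons hΓ hB)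
        (fun i B' e => by
          rcases i with _ | i
          · exact .var (.cons hΓ hB) e
          · exact (hs i B' e).shift hB)
        (fun j B' e => (hf j B' e).shift hB))

theorem Respects.clause_hasTyC {Γ h E S D o Ao Bo co} (hR : Respects Γ h E S D)
    (e : S.lookup o = some (Ao, Bo)) (e' : h.lookup o = some co) :
    HasTyC (.fn Bo D :: Ao :: Γ) co D := by
  cases hR.hasTyH with | mk _ _ _ _ _ h => exact h _ _ _ _ e e'

mutual
theorem EqV.hasTyV : ∀ {Γ v w A}, EqV Γ v w A → HasTyV Γ v A ∧ HasTyV Γ w A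
  | _, _, _, _, .refl h => ⟨h, h⟩
  | _, _, _, _, .symm h => h.hasTyV.symm
  | _, _, _, _, .trans h₁ h₂ => ⟨h₁.hasTyV.1, h₂.hasTyV.2⟩
  | _, _, _, _, .conv h e h' => ⟨.conv h.hasTyV.1 e h', .conv h.hasTyV.2 e h'⟩
  | _, _, _, _, .subst h hΔ hs => ⟨h.hasTyV.1.subst hΔ hs, h.hasTyV.2.subst hΔ hs⟩
  | _, _, _, _, .fn h => ⟨.fn h.hasTyC.1, .fn h.hasTyC.2⟩
  | _, _, _, _, .handler h h₁ h₂ _ => ⟨.handler h.hasTyC.1 h₁, .handler h.hasTyC.2 h₂⟩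
  | _, _, _, _, .eta_unit h => ⟨h, .unit h.wf.1⟩
  | _, _, _, _, .eta_fn h => by
      obtain ⟨hΓ, hA⟩ := h.wf
      cases hA with
      | fn hA hC => exact ⟨h, .fn (.app (h.shift hA) (.var (.cons hΓ hA) rfl))⟩
theorem EqC.hasTyC : ∀ {Γ c d C}, EqC Γ c d C → HasTyC Γ c C ∧ HasTyC Γ d C
  | _, _, _, _, .refl h => ⟨h, h⟩
  | _, _, _, _, .symm h => h.hasTyC.symm
  | _, _, _, _, .trans h₁ h₂ => ⟨h₁.hasTyC.1, h₂.hasTyC.2⟩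
  | _, _, _, _, .conv h e h' => ⟨.conv h.hasTyC.1 e h', .conv h.hasTyC.2 e h'⟩
  | _, _, _, _, .subst h hΔ hs => ⟨h.hasTyC.1.subst hΔ hs, h.hasTyC.2.subst hΔ hs⟩
  | _, _, _, _, .ite h₁ h₂ h₃ =>
      ⟨.ite h₁.hasTyV.1 h₂.hasTyC.1 h₃.hasTyC.1, .ite h₁.hasTyV.2 h₂.hasTyC.2 h₃.hasTyC.2⟩
  | _, _, _, _, .app h₁ h₂ => ⟨.app h₁.hasTyV.1 h₂.hasTyV.1, .app h₁.hasTyV.2 h₂.hasTyV.2⟩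
  | _, _, _, _, .ret h h' => ⟨.ret h.hasTyV.1 h', .ret h.hasTyV.2 h'⟩
  | _, _, _, _, .op e h₁ h₂ => ⟨.op e h₁.hasTyV.1 h₂.hasTyC.1, .op e h₁.hasTyV.2 h₂.hasTyC.2⟩
  | _, _, _, _, .bind h₁ h₂ => ⟨.bind h₁.hasTyC.1 h₂.hasTyC.1, .bind h₁.hasTyC.2 h₂.hasTyC.2⟩
  | _, _, _, _, .handle h₁ h₂ =>
      ⟨.handle h₁.hasTyV.1 h₂.hasTyC.1, .handle h₁.hasTyV.2 h₂.hasTyC.2⟩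
  | _, _, _, _, .beta_tt h₁ h₂ => ⟨.ite (.tt h₁.wf.1) h₁ h₂, h₁⟩
  | _, _, _, _, .beta_ff h₁ h₂ => ⟨.ite (.ff h₁.wf.1) h₁ h₂, h₂⟩
  | _, _, _, _, .beta_fn h hv => ⟨.app (.fn h) hv, h.subst_one hv⟩
  | _, _, _, _, .beta_bind_ret (A := A) (S := S) (E := E) hv h => by
      refine ⟨.bind (.ret hv ?_) h, h.subst_one hv⟩
      cases h.wf.2 with | mk _ hS hE => exact .mk hv.wf.2 hS hE
  | _, _, _, _, .beta_bind_op e hv h₁ h₂ =>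
      ⟨.bind (.op e hv h₁) h₂, .op e hv (.bind h₁ (h₂.rename_bind h₁.wf.1.of_cons.2))⟩
  | _, _, _, _, .beta_handle_ret h hR hv =>
      ⟨.handle (.handler h hR) (.ret hv (.mk hv.wf.2 hR.wfTheory.wfSig hR.wfTheory)),
        h.subst_one hv⟩
  | _, _, _, _, .beta_handle_op h hR e e' hv hc =>
      ⟨.handle (.handler h hR) (.op e hv hc), (hR.clause_hasTyC e e').subst_two hv
        (.fn (.handle ((HasTyV.handler h hR).shift hc.wf.1.of_cons.2) hc))⟩
  | _, _, _, _, .eta_bool hv h =>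
      ⟨h.subst_one hv, .ite hv (h.subst_one (.tt hv.wf.1)) (h.subst_one (.ff hv.wf.1))⟩
  | _, _, _, _, .eta_bind h => by
      refine ⟨h, ?_⟩
      obtain ⟨hΓ, hC⟩ := h.wf
      cases hC with
      | mk hA hS hE =>
        exact .bind h (.ret (.var (.cons hΓ hA) rfl) (.mk hA hS hE))
  | _, _, _, _, .inherit hΓ hC e hs hf => by
      have hT := by
        cases hC with | mk _ _ hE => exact hE.wfT e
      exact ⟨hT.1.inst_hasTyC hC hΓ hs hf, hT.2.inst_hasTyC hC hΓ hs hf⟩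
end

/-! ### Interpretation of types by partial equivalence relations on terms -/

/-- Partial equivalence relations. -/
structure PER (α : Type) where
  rel : α → α → Prop
  symm : ∀ {a b}, rel a b → rel b a
  trans : ∀ {a b c}, rel a b → rel b c → rel a c

theorem PER.left {α : Type} (R : PER α) {a b : α} (h : R.rel a b) : R.rel a a :=
  R.trans h (R.symm h)

theorem PER.right {α : Type} (R : PER α) {a b : α} (h : R.rel a b) : R.rel b b :=
  R.trans (R.symm h) h

/-- Related environments. -/
def EnvRel (X : List (PER Val)) (σ τ : ℕ → Val) : Prop :=
  ∀ (i : ℕ) (R : PER Val), X[i]? = some R → R.rel (σ i) (τ i)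

theorem EnvRel.symm {X : List (PER Val)} {σ τ : ℕ → Val} (h : EnvRel X σ τ) : EnvRel X τ σ :=
  fun i R e => R.symm (h i R e)

theorem EnvRel.left {X : List (PER Val)} {σ τ : ℕ → Val} (h : EnvRel X σ τ) : EnvRel X σ σ :=
  fun i R e => R.left (h i R e)

theorem EnvRel.right {X : List (PER Val)} {σ τ : ℕ → Val} (h : EnvRel X σ τ) : EnvRel X τ τ :=
  fun i R e => R.right (h i R e)

theorem EnvRel.scons {X : List (PER Val)} {σ τ : ℕ → Val} (h : EnvRel X σ τ) {R : PER Val}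
    {u v : Val} (hu : R.rel u v) : EnvRel (R :: X) (scons u σ) (scons v τ) := by
  intro i R' e
  rcases i with _ | i
  · simp at e; exact e ▸ hu
  · exact h i R' (by simpa using e)

/-- Interpretations of signatures. -/
abbrev SigPER := ℕ → Option (PER Val × PER Val)

/-- Interpretations of theories. -/
abbrev TheoryPER := List (PER Val) → List (PER Val) → Tmpl → Tmpl → Prop

def unitPER : PER Val where
  rel v w := v = .unit ∧ w = .unit
  symm h := h.symm
  trans h h' := ⟨h.1, h'.2⟩

def boolPER : PER Val where
  rel v w := (v = .tt ∧ w = .tt) ∨ (v = .ff ∧ w = .ff)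
  symm h := h.imp And.symm And.symm
  trans := by
    rintro _ _ _ (⟨rfl, rfl⟩ | ⟨rfl, rfl⟩) (⟨h, rfl⟩ | ⟨h, rfl⟩)
    · exact .inl ⟨rfl, rfl⟩
    · cases h
    · cases h
    · exact .inr ⟨rfl, rfl⟩

def fnPER (R : PER Val) (Q : PER Comp) : PER Val where
  rel f g := ∀ u v, R.rel u v → Q.rel (.app f u) (.app g v)
  symm h u v e := Q.symm (h v u (R.symm e))
  trans h h' u v e := Q.trans (h u v e) (h' v v (R.right e))

def handlerPER (P Q : PER Comp) : PER Val where
  rel f g := ∀ c d, P.rel c d → Q.rel (.handle f c) (.handle g d)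
  symm h c d e := Q.symm (h d c (P.symm e))
  trans h h' c d e := Q.trans (h c d e) (h' d d (P.right e))

/-- Templates whose values respect the interpretations of types. -/
inductive TmplValid (S : SigPER) (Z : List (PER Val)) : List (PER Val) → Tmpl → Prop
  | app {X z v R} : Z[z]? = some R →
      (∀ σ τ, EnvRel X σ τ → R.rel (v.subst σ) (v.subst τ)) → TmplValid S Z X (.app z v)
  | ite {X v T₁ T₂} : (∀ σ τ, EnvRel X σ τ → boolPER.rel (v.subst σ) (v.subst τ)) →
      TmplValid S Z X T₁ → TmplValid S Z X T₂ → TmplValid S Z X (.ite v T₁ T₂)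
  | op {X o v T R Q} : S o = some (R, Q) →
      (∀ σ τ, EnvRel X σ τ → R.rel (v.subst σ) (v.subst τ)) →
      TmplValid S Z (Q :: X) T → TmplValid S Z X (.op o v T)

/-- The relation on computations generated by returned values, operations, equations between
templates, and reduction. -/
inductive CompRel (R : PER Val) (S : SigPER) (E : TheoryPER) : Comp → Comp → Prop
  | ret {v w} : R.rel v w → CompRel R S E (.ret v) (.ret w)
  | op {o v w c d P Q} : S o = some (P, Q) → P.rel v w →
      (∀ u u', Q.rel u u' → CompRel R S E (c.subst (one u)) (d.subst (one u'))) →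
      CompRel R S E (.op o v c) (.op o w d)
  | eqn {X Z T₁ T₂ f g σ τ} : E X Z T₁ T₂ → TmplValid S Z X T₁ → TmplValid S Z X T₂ →
      EnvRel X σ τ →
      (∀ (j : ℕ) (Q : PER Val), Z[j]? = some Q → ∀ u u', Q.rel u u' →
        CompRel R S E (.app (f j) u) (.app (g j) u')) →
      CompRel R S E (T₁.inst f σ) (T₂.inst g τ)
  | expand {c d e} : Step c d → CompRel R S E d e → CompRel R S E c e
  | reduce {c d e} : Step c d → CompRel R S E c e → CompRel R S E d e
  | symm {c d} : CompRel R S E c d → CompRel R S E d c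
  | trans {c d e} : CompRel R S E c d → CompRel R S E d e → CompRel R S E c e

def compPER (R : PER Val) (S : SigPER) (E : TheoryPER) : PER Comp where
  rel := CompRel R S E
  symm := .symm
  trans := .trans

mutual
def VTy.per : VTy → PER Val
  | .unit => unitPER
  | .bool => boolPER
  | .fn A C => fnPER A.per C.per
  | .handler C D => handlerPER C.per D.per
def CTy.per : CTy → PER Comp
  | .mk A S E => compPER A.per S.per E.per
def Sig.per : Sig → SigPER
  | .nil => fun _ => none
  | .cons o A B S => fun o' => if o' = o then some (A.per, B.per) else S.per o'
def Theory.per : Theory → TheoryPER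
  | .nil => fun _ _ _ _ => False
  | .cons X Z T₁ T₂ E => fun X' Z' T₁' T₂' =>
      (X' = ctxPER X ∧ Z' = ctxPER Z ∧ T₁' = T₁ ∧ T₂' = T₂) ∨ E.per X' Z' T₁' T₂'
def ctxPER : List VTy → List (PER Val)
  | [] => []
  | A :: X => A.per :: ctxPER X
end

theorem ctxPER_eq_map : ∀ X : Ctx, ctxPER X = X.map VTy.per
  | [] => by simp [ctxPER]
  | A :: X => by simp [ctxPER, ctxPER_eq_map X]

theorem ctxPER_getElem? {X : Ctx} {i : ℕ} {A : VTy} (e : X[i]? = some A) :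
    (ctxPER X)[i]? = some A.per := by
  simp [ctxPER_eq_map, e]

theorem ctxPER_getElem?_eq_some {X : Ctx} {i : ℕ} {R : PER Val} (e : (ctxPER X)[i]? = some R) :
    ∃ A, X[i]? = some A ∧ R = A.per := by
  rw [ctxPER_eq_map, List.getElem?_map, Option.map_eq_some_iff] at e
  obtain ⟨A, e, rfl⟩ := e
  exact ⟨A, e, rfl⟩

theorem Sig.per_of_lookup : ∀ {S : Sig} {o : ℕ} {A B : VTy}, S.lookup o = some (A, B) →
    S.per o = some (A.per, B.per)
  | .cons o' A' B' S, o, A, B, e => by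
      simp only [Sig.lookup] at e
      simp only [Sig.per]
      split at e
      · cases e; simp [*]
      · simp [*, Sig.per_of_lookup e]

theorem Sig.per_eq_some : ∀ {S : Sig} {o : ℕ} {R Q : PER Val}, S.per o = some (R, Q) →
    ∃ A B, S.lookup o = some (A, B) ∧ R = A.per ∧ Q = B.per
  | .nil, o, R, Q, e => by simp [Sig.per] at e
  | .cons o' A' B' S, o, R, Q, e => by
      simp only [Sig.per] at e
      simp only [Sig.lookup]
      split at e
      · cases e; exact ⟨A', B', by simp [*]⟩
      · simpa [*] using Sig.per_eq_some e

theorem Theory.per_of_mem {X Z : Ctx} {T₁ T₂ : Tmpl} : ∀ {E : Theory}, E.Mem X Z T₁ T₂ →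
    E.per (ctxPER X) (ctxPER Z) T₁ T₂
  | .cons X' Z' T₁' T₂' E, e => by
      simp only [Theory.per]
      rcases e with ⟨rfl, rfl, rfl, rfl⟩ | e
      · exact .inl ⟨rfl, rfl, rfl, rfl⟩
      · exact .inr (Theory.per_of_mem e)

/-! Equal types have equal interpretations. -/

mutual
theorem VTyEq.per_eq : ∀ {A B}, VTyEq A B → A.per = B.per
  | _, _, .unit => rfl
  | _, _, .bool => rfl
  | _, _, .fn h h' => by simp only [VTy.per]; rw [h.per_eq, h'.per_eq]
  | _, _, .handler h h' => by simp only [VTy.per]; rw [h.per_eq, h'.per_eq]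
theorem CTyEq.per_eq : ∀ {C D}, CTyEq C D → C.per = D.per
  | _, _, .mk h h' h'' => by simp only [CTy.per]; rw [h.per_eq, h'.per_eq, h''.per_eq]
theorem SigEq.per_eq : ∀ {S S'}, SigEq S S' → S.per = S'.per
  | _, _, .nil => rfl
  | _, _, .cons h h' h'' => by simp only [Sig.per]; rw [h.per_eq, h'.per_eq, h''.per_eq]
  | _, _, .swap h => by
      funext o
      simp only [Sig.per]
      split
      · rename_i e; subst e; rw [if_neg h]
      · rfl
  | _, _, .trans h h' => h.per_eq.trans h'.per_eq
theorem CtxEq.per_eq : ∀ {X Y}, CtxEq X Y → ctxPER X = ctxPER Y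
  | _, _, .nil => rfl
  | _, _, .cons h h' => by simp only [ctxPER]; rw [h.per_eq, h'.per_eq]
theorem TheoryEq.per_eq : ∀ {E E'}, TheoryEq E E' → E.per = E'.per
  | _, _, .nil => rfl
  | _, _, .cons h h' h'' => by simp only [Theory.per]; rw [h.per_eq, h'.per_eq, h''.per_eq]
  | _, _, .swap => by
      funext _ _ _ _
      simp only [Theory.per, ← or_assoc]
      rw [or_comm (a := _ ∧ _)]
  | _, _, .dup => by
      funext _ _ _ _
      simp only [Theory.per, ← or_assoc, or_self]
  | _, _, .symm h => h.per_eq.symm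
  | _, _, .trans h h' => h.per_eq.trans h'.per_eq
end

theorem CTy.per_expand {C : CTy} {c d e : Comp} (h : Step c d) (h' : C.per.rel d e) :
    C.per.rel c e := by
  cases C; simp only [CTy.per] at *; exact .expand h h'

theorem CTy.per_reduce {C : CTy} {c d e : Comp} (h : Step c d) (h' : C.per.rel c e) :
    C.per.rel d e := by
  cases C; simp only [CTy.per] at *; exact .reduce h h'

theorem CTy.per_expand₂ {C : CTy} {c c' d d' : Comp} (h : Step c c') (h' : Step d d')
    (e : C.per.rel c' d') : C.per.rel c d :=
  C.per_expand h (C.per.symm (C.per_expand h' (C.per.symm e)))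

theorem CTy.per_reduce_right {C : CTy} {c d e : Comp} (h : Step d e) (h' : C.per.rel c d) :
    C.per.rel c e :=
  C.per.symm (C.per_reduce h (C.per.symm h'))

/-! ### Sequencing -/

section Bind

variable {S : SigPER} {E : TheoryPER} {R R' : PER Val}

theorem CompRel.expand_right {c d e : Comp} (h : Step d e) (h' : CompRel R S E c e) :
    CompRel R S E c d :=
  .symm (.expand h (.symm h'))

/-- Sequencing after a template amounts to sequencing after the computations substituted in it. -/
theorem TmplValid.bind_inst {X Z : List (PER Val)} {T : Tmpl} (hT : TmplValid S Z X T) (c : Comp)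
    {f g : ℕ → Val} : ∀ {σ τ : ℕ → Val}, EnvRel X σ τ →
    (∀ (j : ℕ) (Q : PER Val), Z[j]? = some Q → ∀ u u', Q.rel u u' →
      CompRel R S E (.bind (.app (f j) u) c) (.app (g j) u')) →
    CompRel R S E (.bind (T.inst f σ) c) (T.inst g τ) := by
  induction hT with
  | app hz hv => intro σ τ hs hf; exact hf _ _ hz _ _ (hv _ _ hs)
  | ite hv _ _ ih₁ ih₂ =>
      intro σ τ hs hf
      simp only [Tmpl.inst]
      rcases hv _ _ hs with ⟨e, e'⟩ | ⟨e, e'⟩ <;> rw [e, e']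
      · exact .expand (.bind_step _ (.ite_tt _ _)) (.expand_right (.ite_tt _ _) (ih₁ hs hf))
      · exact .expand (.bind_step _ (.ite_ff _ _)) (.expand_right (.ite_ff _ _) (ih₂ hs hf))
  | op ho hv _ ih =>
      intro σ τ hs hf
      refine .expand (.bind_op _ _ _ _) (.op ho (hv _ _ hs) fun u u' hu => ?_)
      simp only [Comp.subst, Tmpl.inst_lift_subst_one, Comp.liftRen_succ_subst_liftSub_one]
      exact ih (hs.scons hu) hf

theorem CompRel.bind {c c' : Comp} (h : CompRel R S E c c') : ∀ {d d' : Comp},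
    (∀ u u', R.rel u u' → CompRel R' S E (d.subst (one u)) (d'.subst (one u'))) →
    CompRel R' S E (.bind c d) (.bind c' d') := by
  induction h with
  | ret hv =>
      intro d d' hd
      exact .expand (.bind_ret _ _) (.expand_right (.bind_ret _ _) (hd _ _ hv))
  | op ho hv _ ih =>
      intro d d' hd
      refine .expand (.bind_op _ _ _ _) (.expand_right (.bind_op _ _ _ _) (.op ho hv ?_))
      intro u u' hu
      simp only [Comp.subst, Comp.liftRen_succ_subst_liftSub_one]
      exact ih u u' hu hd
  | @eqn X Z T₁ T₂ f g σ τ hE hT₁ hT₂ hs _ ih =>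
      intro d d' hd
      have hd₂ : ∀ u u', R.rel u u' → CompRel R' S E (d'.subst (one u)) (d.subst (one u')) :=
        fun u u' hu => .symm (hd _ _ (R.symm hu))
      let seq (c : Comp) (f : ℕ → Val) (j : ℕ) : Val :=
        .fn (.bind (.app (f j).shift (.var 0)) (c.rename (liftRen Nat.succ)))
      have hstep : ∀ c f j u, Step (.app (seq c f j) u) (.bind (.app (f j) u) c) := by
        intro c f j u
        have := Step.app_fn (.bind (.app (f j).shift (.var 0)) (c.rename (liftRen Nat.succ))) u
        simp only [Comp.subst, Val.subst, Val.shift_subst_one,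
          Comp.liftRen_succ_subst_liftSub_one] at this
        exact this
      have h₁ : CompRel R' S E (.bind (T₁.inst f σ) d) (T₁.inst (seq d f) σ) :=
        hT₁.bind_inst d hs.left fun j Q hj u u' hu =>
          .expand_right (hstep _ _ _ _)
            (.trans (ih j Q hj u u' hu hd) (.symm (ih j Q hj u' u' (Q.right hu) hd)))
      have h₂ : CompRel R' S E (.bind (T₂.inst g τ) d') (T₂.inst (seq d' g) τ) :=
        hT₂.bind_inst d' hs.right fun j Q hj u u' hu =>
          .expand_right (hstep _ _ _ _)
            (.trans (.symm (ih j Q hj u u (Q.left hu) hd)) (ih j Q hj u u' hu hd))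
      refine .trans h₁ (.trans (.eqn hE hT₁ hT₂ hs fun j Q hj u u' hu => ?_) (.symm h₂))
      exact .expand (hstep _ _ _ _) (.expand_right (hstep _ _ _ _) (ih j Q hj u u' hu hd))
  | expand hst _ ih => intro d d' hd; exact .expand (.bind_step _ hst) (ih hd)
  | reduce hst _ ih => intro d d' hd; exact .reduce (.bind_step _ hst) (ih hd)
  | symm _ ih => intro d d' hd; exact .symm (ih fun u u' hu => .symm (hd _ _ (R.symm hu)))
  | trans _ _ ih₁ ih₂ =>
      intro d d' hd
      exact .trans (ih₁ hd) (ih₂ fun u u' hu =>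
        .trans (.symm (hd u u (R.left hu))) (hd u u' hu))

theorem CompRel.bind_ret_var {c c' : Comp} (h : CompRel R S E c c') :
    CompRel R S E c (.bind c' (.ret (.var 0))) := by
  have hret : ∀ u u', R.rel u u' → CompRel R S E ((Comp.ret (.var 0)).subst (one u))
      ((Comp.ret (.var 0)).subst (one u')) := fun u u' hu => .ret hu
  induction h with
  | ret hv => exact .expand_right (.bind_ret _ _) (.ret hv)
  | op ho hv _ ih =>
      refine .expand_right (.bind_op _ _ _ _) (.op ho hv fun u u' hu => ?_)
      exact ih u u' hu
  | @eqn X Z T₁ T₂ f g σ τ hE hT₁ hT₂ hs hf ih =>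
      refine .trans (.eqn hE hT₁ hT₂ hs hf) (.symm (hT₂.bind_inst _ hs.right ?_))
      intro j Q hj u u' hu
      exact .trans (.symm (ih j Q hj u u (Q.left hu))) (hf j Q hj u u' hu)
  | expand hst _ ih => exact .expand hst ih
  | reduce hst _ ih => exact .reduce hst ih
  | symm h ih => exact .trans (.symm h) (.trans ih (h.symm.bind hret))
  | trans h₁ _ _ ih₂ => exact .trans h₁ ih₂

end Bind

/-! ### Handling -/

/-- Operation clauses that handle related calls by related computations of type `D`. -/
def ClausesRel (S : SigPER) (D : CTy) (h h' : Clauses) : Prop :=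
  ∀ o P Q, S o = some (P, Q) → ∃ co co', h.lookup o = some co ∧ h'.lookup o = some co' ∧
    ∀ v v' k k', P.rel v v' → (fnPER Q D.per).rel k k' →
      D.per.rel (co.subst (two v k)) (co'.subst (two v' k'))

theorem ClausesRel.symm {S : SigPER} {D : CTy} {h h' : Clauses} (H : ClausesRel S D h h') :
    ClausesRel S D h' h := by
  intro o P Q e
  obtain ⟨co, co', hco, hco', H⟩ := H o P Q e
  exact ⟨co', co, hco', hco, fun v v' k k' hv hk =>
    D.per.symm (H v' v k' k (P.symm hv) ((fnPER Q D.per).symm hk))⟩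

theorem ClausesRel.left {S : SigPER} {D : CTy} {h h' : Clauses} (H : ClausesRel S D h h') :
    ClausesRel S D h h := by
  intro o P Q e
  obtain ⟨co, co', hco, hco', H⟩ := H o P Q e
  exact ⟨co, co, hco, hco, fun v v' k k' hv hk =>
    D.per.trans (H v v' k k' hv hk)
      (D.per.symm (H v' v' k' k' (P.right hv) ((fnPER Q D.per).right hk)))⟩

/-- Operation clauses that validate the equations of a theory. -/
def ClausesRespect (E : TheoryPER) (D : CTy) (h : Clauses) : Prop :=
  ∀ X Z T₁ T₂, E X Z T₁ T₂ → ∀ f g σ τ, EnvRel X σ τ →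
    (∀ (j : ℕ) (Q : PER Val), Z[j]? = some Q → (fnPER Q D.per).rel (f j) (g j)) →
    D.per.rel (T₁.handled h f σ) (T₂.handled h g τ)

theorem TmplValid.handle_inst {S : SigPER} {X Z : List (PER Val)} {T : Tmpl}
    (hT : TmplValid S Z X T) {cr : Comp} {h h' : Clauses} {D : CTy} (H : ClausesRel S D h h')
    {f g : ℕ → Val} : ∀ {σ τ : ℕ → Val}, EnvRel X σ τ →
    (∀ (j : ℕ) (Q : PER Val), Z[j]? = some Q → ∀ u u', Q.rel u u' →
      D.per.rel (.handle (.handler cr h) (.app (f j) u)) (.app (g j) u')) →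
    D.per.rel (.handle (.handler cr h) (T.inst f σ)) (T.handled h' g τ) := by
  induction hT with
  | app hz hv => intro σ τ hs hf; exact hf _ _ hz _ _ (hv _ _ hs)
  | ite hv _ _ ih₁ ih₂ =>
      intro σ τ hs hf
      simp only [Tmpl.inst, Tmpl.handled]
      rcases hv _ _ hs with ⟨e, e'⟩ | ⟨e, e'⟩ <;> rw [e, e']
      · exact CTy.per_expand₂ (.handle_step _ (.ite_tt _ _)) (.ite_tt _ _) (ih₁ hs hf)
      · exact CTy.per_expand₂ (.handle_step _ (.ite_ff _ _)) (.ite_ff _ _) (ih₂ hs hf)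
  | op ho hv _ ih =>
      intro σ τ hs hf
      obtain ⟨co, co', hco, hco', H⟩ := H _ _ _ ho
      simp only [Tmpl.inst, Tmpl.handled, hco']
      refine CTy.per_expand (.handle_op _ _ _ _ hco) (H _ _ _ _ (hv _ _ hs) fun u u' hu => ?_)
      refine CTy.per_expand₂ (.app_fn _ _) (.app_fn _ _) ?_
      simp only [Comp.subst, Tmpl.inst_lift_subst_one, Val.shift_subst_one,
        Tmpl.handled_lift_subst_one]
      exact ih (hs.scons hu) hf

theorem handler_rel {R : PER Val} {S : SigPER} {E : TheoryPER} {D : CTy} {c c' : Comp}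
    (hc : CompRel R S E c c') : ∀ {cr cr' : Comp} {h h' : Clauses},
    (∀ u u', R.rel u u' → D.per.rel (cr.subst (one u)) (cr'.subst (one u'))) →
    ClausesRel S D h h' → ClausesRespect E D h → ClausesRespect E D h' →
    D.per.rel (.handle (.handler cr h) c) (.handle (.handler cr' h') c') := by
  induction hc with
  | ret hv =>
      intro cr cr' h h' hcr _ _ _
      exact CTy.per_expand₂ (.handle_ret _ _ _) (.handle_ret _ _ _) (hcr _ _ hv)
  | op ho hv _ ih =>
      intro cr cr' h h' hcr H hE hE'
      obtain ⟨co, co', hco, hco', Ho⟩ := H _ _ _ ho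
      refine CTy.per_expand₂ (.handle_op _ _ _ _ hco) (.handle_op _ _ _ _ hco')
        (Ho _ _ _ _ hv fun u u' hu => ?_)
      refine CTy.per_expand₂ (.app_fn _ _) (.app_fn _ _) ?_
      simp only [Comp.subst, Val.shift_subst_one]
      exact ih u u' hu hcr H hE hE'
  | @eqn X Z T₁ T₂ f g σ τ hT hT₁ hT₂ hs _ ih =>
      intro cr cr' h h' hcr H hE hE'
      let wrap (H : Val) (f : ℕ → Val) (j : ℕ) : Val :=
        .fn (.handle H.shift (.app (f j).shift (.var 0)))
      have hstep : ∀ H f j u, Step (.app (wrap H f j) u) (.handle H (.app (f j) u)) := by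
        intro H f j u
        have := Step.app_fn (.handle H.shift (.app (f j).shift (.var 0))) u
        simp only [Comp.subst, Val.subst, Val.shift_subst_one] at this
        exact this
      have ih' : ∀ (j : ℕ) (Q : PER Val), Z[j]? = some Q → ∀ u u', Q.rel u u' →
          D.per.rel (.handle (.handler cr h) (.app (f j) u))
            (.handle (.handler cr' h') (.app (g j) u')) :=
        fun j Q hj u u' hu => ih j Q hj u u' hu hcr H hE hE'
      have h₁ : D.per.rel (.handle (.handler cr h) (T₁.inst f σ))
          (T₁.handled h (wrap (.handler cr h) f) σ) :=
        hT₁.handle_inst H.left hs.left fun j Q hj u u' hu =>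
          D.per.symm (CTy.per_expand (hstep _ _ _ _)
            (D.per.trans (ih' j Q hj u' u' (Q.right hu)) (D.per.symm (ih' j Q hj u u' hu))))
      have h₂ : D.per.rel (.handle (.handler cr' h') (T₂.inst g τ))
          (T₂.handled h (wrap (.handler cr' h') g) τ) :=
        hT₂.handle_inst H.symm hs.right fun j Q hj u u' hu =>
          D.per.symm (CTy.per_expand (hstep _ _ _ _)
            (D.per.trans (D.per.symm (ih' j Q hj u u' hu)) (ih' j Q hj u u (Q.left hu))))
      refine D.per.trans h₁ (D.per.trans (hE X Z T₁ T₂ hT _ _ _ _ hs ?_) (D.per.symm h₂))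
      intro j Q hj u u' hu
      exact CTy.per_expand₂ (hstep _ _ _ _) (hstep _ _ _ _) (ih' j Q hj u u' hu)
  | expand hst _ ih =>
      intro cr cr' h h' hcr H hE hE'
      exact CTy.per_expand (.handle_step _ hst) (ih hcr H hE hE')
  | reduce hst _ ih =>
      intro cr cr' h h' hcr H hE hE'
      exact CTy.per_reduce (.handle_step _ hst) (ih hcr H hE hE')
  | symm _ ih =>
      intro cr cr' h h' hcr H hE hE'
      exact D.per.symm (ih (fun u u' hu => D.per.symm (hcr _ _ (R.symm hu))) H.symm hE' hE)
  | trans _ _ ih₁ ih₂ =>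
      intro cr cr' h h' hcr H hE hE'
      exact D.per.trans (ih₁ (fun u u' hu =>
        D.per.trans (hcr u u' hu) (D.per.symm (hcr u' u' (R.right hu)))) H.left hE hE)
        (ih₂ hcr H hE hE')

/-! ### Related computations of ground type behave alike -/

theorem Step.deterministic {c d : Comp} (h : Step c d) : ∀ {e : Comp}, Step c e → d = e := by
  induction h with
  | ite_tt | ite_ff | app_fn => rintro _ ⟨⟩; rfl
  | bind_step _ h ih =>
      intro e h'
      cases h' with
      | bind_step _ h' => rw [ih h']
      | bind_ret | bind_op => cases h
  | bind_ret =>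
      intro e h'
      cases h' with
      | bind_step _ h' => cases h'
      | bind_ret => rfl
  | bind_op =>
      intro e h'
      cases h' with
      | bind_step _ h' => cases h'
      | bind_op => rfl
  | handle_step _ h ih =>
      intro e h'
      cases h' with
      | handle_step _ h' => rw [ih h']
      | handle_ret | handle_op => cases h
  | handle_ret =>
      intro e h'
      cases h' with
      | handle_step _ h' => cases h'
      | handle_ret => rfl
  | handle_op _ _ _ _ ho =>
      intro e h'
      cases h' with
      | handle_step _ h' => cases h'
      | handle_op _ _ _ _ ho' => rw [ho] at ho'; cases ho'; rfl

theorem steps_ret_iff_of_step {c d : Comp} {v : Val} (h : Step c d) :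
    Steps c (.ret v) ↔ Steps d (.ret v) := by
  refine ⟨fun h' => ?_, .head h⟩
  rcases h'.cases_head with rfl | ⟨e, h₁, h₂⟩
  · cases h
  · rwa [h.deterministic h₁]

theorem steps_ret_tt_iff {c d : Comp} (h : groundTy.per.rel c d) :
    Steps c (.ret .tt) ↔ Steps d (.ret .tt) := by
  simp only [CTy.per] at h
  change CompRel _ _ _ c d at h
  induction h with
  | ret h =>
      simp only [VTy.per] at h
      rcases h with ⟨rfl, rfl⟩ | ⟨rfl, rfl⟩ <;> rfl
  | op e => simp [Sig.per] at e
  | eqn e => simp [Theory.per] at e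
  | expand h _ ih => exact (steps_ret_iff_of_step h).trans ih
  | reduce h _ ih => exact (steps_ret_iff_of_step h).symm.trans ih
  | symm _ ih => exact ih.symm
  | trans _ _ ih₁ ih₂ => exact ih₁.trans ih₂

/-! ### Semantic equality of open terms -/

/-- Semantic equality of values. -/
def SemV (Γ : Ctx) (v w : Val) (A : VTy) : Prop :=
  ∀ σ τ, EnvRel (ctxPER Γ) σ τ → A.per.rel (v.subst σ) (w.subst τ)

/-- Semantic equality of computations. -/
def SemC (Γ : Ctx) (c d : Comp) (C : CTy) : Prop :=
  ∀ σ τ, EnvRel (ctxPER Γ) σ τ → C.per.rel (c.subst σ) (d.subst τ)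

/-- Semantic counterpart of `Respects`. -/
def SemR (Γ : Ctx) (h : Clauses) (E : Theory) (S : Sig) (D : CTy) : Prop :=
  (∀ σ τ, EnvRel (ctxPER Γ) σ τ → ClausesRel S.per D (h.subst σ) (h.subst τ)) ∧
    ∀ σ, EnvRel (ctxPER Γ) σ σ → ClausesRespect E.per D (h.subst σ)

/-- All templates of the theory are semantically valid. -/
def Theory.Valid (S : Sig) (E : Theory) : Prop :=
  ∀ X Z T₁ T₂, E.Mem X Z T₁ T₂ → TmplValid S.per (ctxPER Z) (ctxPER X) T₁ ∧
    TmplValid S.per (ctxPER Z) (ctxPER X) T₂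

def CTy.Valid : CTy → Prop
  | .mk _ S E => E.Valid S

theorem EnvRel.get {Γ : Ctx} {σ τ : ℕ → Val} (h : EnvRel (ctxPER Γ) σ τ) {n : ℕ} {A : VTy}
    (e : Γ[n]? = some A) : A.per.rel (σ n) (τ n) :=
  h n _ (ctxPER_getElem? e)

theorem envRel_of_get {Γ : Ctx} {σ τ : ℕ → Val}
    (h : ∀ (n : ℕ) (A : VTy), Γ[n]? = some A → A.per.rel (σ n) (τ n)) :
    EnvRel (ctxPER Γ) σ τ := by
  intro n R e
  obtain ⟨A, e', rfl⟩ := ctxPER_getElem?_eq_some e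
  exact h n A e'

theorem SemV.symm {Γ : Ctx} {v w : Val} {A : VTy} (h : SemV Γ v w A) : SemV Γ w v A :=
  fun σ τ hs => A.per.symm (h τ σ hs.symm)

theorem SemC.symm {Γ : Ctx} {c d : Comp} {C : CTy} (h : SemC Γ c d C) : SemC Γ d c C :=
  fun σ τ hs => C.per.symm (h τ σ hs.symm)

theorem SemV.trans {Γ : Ctx} {u v w : Val} {A : VTy} (h : SemV Γ u v A) (h' : SemV Γ v w A) :
    SemV Γ u w A :=
  fun σ τ hs => A.per.trans (h σ τ hs) (h' τ τ hs.right)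

theorem SemC.trans {Γ : Ctx} {c d e : Comp} {C : CTy} (h : SemC Γ c d C) (h' : SemC Γ d e C) :
    SemC Γ c e C :=
  fun σ τ hs => C.per.trans (h σ τ hs) (h' τ τ hs.right)

theorem SemC.conv {Γ : Ctx} {c d : Comp} {C C' : CTy} (h : SemC Γ c d C) (e : CTyEq C C') :
    SemC Γ c d C' :=
  fun σ τ hs => e.per_eq ▸ h σ τ hs

theorem SemV.conv {Γ : Ctx} {v w : Val} {A A' : VTy} (h : SemV Γ v w A) (e : VTyEq A A') :
    SemV Γ v w A' :=
  fun σ τ hs => e.per_eq ▸ h σ τ hs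

theorem SemV.subst {Γ Δ : Ctx} {v w : Val} {A : VTy} (h : SemV Γ v w A) {ρ : ℕ → Val}
    (hρ : ∀ i B, Γ[i]? = some B → SemV Δ (ρ i) (ρ i) B) :
    SemV Δ (v.subst ρ) (w.subst ρ) A := by
  intro σ τ hs
  rw [Val.subst_subst, Val.subst_subst]
  exact h _ _ (envRel_of_get fun n B e => hρ n B e σ τ hs)

theorem SemC.subst {Γ Δ : Ctx} {c d : Comp} {C : CTy} (h : SemC Γ c d C) {ρ : ℕ → Val}
    (hρ : ∀ i B, Γ[i]? = some B → SemV Δ (ρ i) (ρ i) B) :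
    SemC Δ (c.subst ρ) (d.subst ρ) C := by
  intro σ τ hs
  rw [Comp.subst_subst, Comp.subst_subst]
  exact h _ _ (envRel_of_get fun n B e => hρ n B e σ τ hs)

theorem Step.subst {c d : Comp} (h : Step c d) (σ : ℕ → Val) :
    Step (c.subst σ) (d.subst σ) := by
  induction h with
  | ite_tt => exact .ite_tt _ _
  | ite_ff => exact .ite_ff _ _
  | app_fn c v =>
      have := Step.app_fn (c.subst (liftSub σ)) (v.subst σ)
      rwa [Comp.liftSub_subst_one, ← one_subst, ← Comp.subst_subst] at this
  | bind_step _ _ ih => exact .bind_step _ ih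
  | bind_ret v c =>
      have := Step.bind_ret (v.subst σ) (c.subst (liftSub σ))
      rwa [Comp.liftSub_subst_one, ← one_subst, ← Comp.subst_subst] at this
  | bind_op o v c₁ c₂ =>
      have := Step.bind_op o (v.subst σ) (c₁.subst (liftSub σ)) (c₂.subst (liftSub σ))
      have e : (c₂.rename (liftRen Nat.succ)).subst (liftSub (liftSub σ)) =
          (c₂.subst (liftSub σ)).rename (liftRen Nat.succ) := by
        rw [Comp.rename_subst, Comp.subst_rename, liftSub_comp_liftRen, liftSub_rename]
        rfl
      simpa only [Comp.subst, e] using this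
  | handle_step _ _ ih => exact .handle_step _ ih
  | handle_ret cr h v =>
      have := Step.handle_ret (cr.subst (liftSub σ)) (h.subst σ) (v.subst σ)
      rwa [Comp.liftSub_subst_one, ← one_subst, ← Comp.subst_subst] at this
  | @handle_op cr h o v c co ho =>
      have := Step.handle_op (cr.subst (liftSub σ)) (h.subst σ) (v.subst σ)
        (c.subst (liftSub σ)) (by rw [Clauses.lookup_subst, ho]; rfl)
      have e : ((Val.handler cr h).subst σ).shift =
          (Val.handler cr h).shift.subst (liftSub σ) :=
        (Val.subst_rename _ _ _).trans (Val.rename_subst (.handler cr h) Nat.succ (liftSub σ)).symm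
      rw [Comp.liftSub_subst_two] at this
      rw [Comp.subst_subst, two_subst]
      simp only [Comp.subst, Val.subst] at e this ⊢
      rwa [e] at this

/-- Semantic equality is preserved by reduction of the right-hand side. -/
theorem SemC.reduce {Γ : Ctx} {c d e : Comp} {C : CTy} (h : SemC Γ c d C)
    (hst : Step d e) : SemC Γ c e C :=
  fun σ τ hs => CTy.per_reduce_right (hst.subst τ) (h σ τ hs)

/-! Compatibility of semantic equality with the term constructors. -/

theorem SemV.var {Γ : Ctx} {n : ℕ} {A : VTy} (e : Γ[n]? = some A) :
    SemV Γ (.var n) (.var n) A :=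
  fun _ _ hs => hs.get e

theorem SemV.unit {Γ : Ctx} : SemV Γ .unit .unit .unit := by
  intro _ _ _; simp only [VTy.per]; exact ⟨rfl, rfl⟩

theorem SemV.tt {Γ : Ctx} : SemV Γ .tt .tt .bool := by
  intro _ _ _; simp only [VTy.per]; exact .inl ⟨rfl, rfl⟩

theorem SemV.ff {Γ : Ctx} : SemV Γ .ff .ff .bool := by
  intro _ _ _; simp only [VTy.per]; exact .inr ⟨rfl, rfl⟩

theorem SemC.subst_scons {Γ : Ctx} {A : VTy} {c c' : Comp} {C : CTy}
    (h : SemC (A :: Γ) c c' C) {σ τ : ℕ → Val} (hs : EnvRel (ctxPER Γ) σ τ) {u u' : Val}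
    (hu : A.per.rel u u') :
    C.per.rel ((c.subst (liftSub σ)).subst (one u)) ((c'.subst (liftSub τ)).subst (one u')) := by
  rw [Comp.liftSub_subst_one, Comp.liftSub_subst_one]
  exact h _ _ (by simpa only [ctxPER] using hs.scons hu)

theorem SemV.fn {Γ : Ctx} {A : VTy} {C : CTy} {c c' : Comp} (h : SemC (A :: Γ) c c' C) :
    SemV Γ (.fn c) (.fn c') (.fn A C) := by
  intro σ τ hs
  simp only [VTy.per]
  intro u u' hu
  exact CTy.per_expand₂ (.app_fn _ _) (.app_fn _ _) (h.subst_scons hs hu)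

theorem clausesRel_subst {Γ : Ctx} {h h' : Clauses} {S : Sig} {D : CTy}
    (H : ∀ o A B, S.lookup o = some (A, B) → ∃ co co', h.lookup o = some co ∧
      h'.lookup o = some co' ∧ SemC (.fn B D :: A :: Γ) co co' D)
    {σ τ : ℕ → Val} (hs : EnvRel (ctxPER Γ) σ τ) :
    ClausesRel S.per D (h.subst σ) (h'.subst τ) := by
  intro o P Q e
  obtain ⟨A, B, e', rfl, rfl⟩ := Sig.per_eq_some e
  obtain ⟨co, co', hco, hco', H⟩ := H o A B e'
  refine ⟨_, _, by rw [Clauses.lookup_subst, hco]; rfl, by rw [Clauses.lookup_subst, hco']; rfl,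
    fun v v' k k' hv hk => ?_⟩
  rw [Comp.liftSub_subst_two, Comp.liftSub_subst_two]
  refine H _ _ ?_
  simp only [ctxPER, VTy.per]
  exact (hs.scons hv).scons hk

theorem SemV.handler {Γ : Ctx} {A : VTy} {S : Sig} {E : Theory} {D : CTy} {cr cr' : Comp}
    {h h' : Clauses} (hcr : SemC (A :: Γ) cr cr' D)
    (H : ∀ σ τ, EnvRel (ctxPER Γ) σ τ → ClausesRel S.per D (h.subst σ) (h'.subst τ))
    (hR : SemR Γ h E S D) (hR' : SemR Γ h' E S D) :
    SemV Γ (.handler cr h) (.handler cr' h') (.handler (.mk A S E) D) := by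
  intro σ τ hs
  simp only [VTy.per, CTy.per]
  intro c c' hc
  exact handler_rel hc (fun u u' hu => hcr.subst_scons hs hu) (H σ τ hs) (hR.2 σ hs.left)
    (hR'.2 τ hs.right)

theorem SemC.ite {Γ : Ctx} {v v' : Val} {c₁ c₁' c₂ c₂' : Comp} {C : CTy}
    (hv : SemV Γ v v' .bool) (h₁ : SemC Γ c₁ c₁' C) (h₂ : SemC Γ c₂ c₂' C) :
    SemC Γ (.ite v c₁ c₂) (.ite v' c₁' c₂') C := by
  intro σ τ hs
  have := hv σ τ hs
  simp only [VTy.per] at this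
  simp only [Comp.subst]
  rcases this with ⟨e, e'⟩ | ⟨e, e'⟩ <;> rw [e, e']
  · exact CTy.per_expand₂ (.ite_tt _ _) (.ite_tt _ _) (h₁ σ τ hs)
  · exact CTy.per_expand₂ (.ite_ff _ _) (.ite_ff _ _) (h₂ σ τ hs)

theorem SemC.app {Γ : Ctx} {v v' w w' : Val} {A : VTy} {C : CTy}
    (hv : SemV Γ v v' (.fn A C)) (hw : SemV Γ w w' A) : SemC Γ (.app v w) (.app v' w') C := by
  intro σ τ hs
  have := hv σ τ hs
  simp only [VTy.per] at this
  exact this _ _ (hw σ τ hs)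

theorem SemC.ret {Γ : Ctx} {v v' : Val} {A : VTy} {S : Sig} {E : Theory} (hv : SemV Γ v v' A) :
    SemC Γ (.ret v) (.ret v') (.mk A S E) := by
  intro σ τ hs
  simp only [CTy.per]
  exact .ret (hv σ τ hs)

theorem SemC.op {Γ : Ctx} {o : ℕ} {v v' : Val} {c c' : Comp} {Ao Bo A : VTy} {S : Sig}
    {E : Theory} (e : S.lookup o = some (Ao, Bo)) (hv : SemV Γ v v' Ao)
    (hc : SemC (Bo :: Γ) c c' (.mk A S E)) : SemC Γ (.op o v c) (.op o v' c') (.mk A S E) := by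
  intro σ τ hs
  simp only [CTy.per]
  refine .op (Sig.per_of_lookup e) (hv σ τ hs) fun u u' hu => ?_
  have := hc.subst_scons hs hu
  simp only [CTy.per] at this
  exact this

theorem SemC.bind {Γ : Ctx} {c₁ c₁' c₂ c₂' : Comp} {A B : VTy} {S : Sig} {E : Theory}
    (h₁ : SemC Γ c₁ c₁' (.mk A S E)) (h₂ : SemC (A :: Γ) c₂ c₂' (.mk B S E)) :
    SemC Γ (.bind c₁ c₂) (.bind c₁' c₂') (.mk B S E) := by
  intro σ τ hs
  have := h₁ σ τ hs
  simp only [CTy.per] at this ⊢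
  refine CompRel.bind this fun u u' hu => ?_
  have := h₂.subst_scons hs hu
  simp only [CTy.per] at this
  exact this

theorem SemC.handle {Γ : Ctx} {v v' : Val} {c c' : Comp} {C D : CTy}
    (hv : SemV Γ v v' (.handler C D)) (hc : SemC Γ c c' C) :
    SemC Γ (.handle v c) (.handle v' c') D := by
  intro σ τ hs
  have := hv σ τ hs
  simp only [VTy.per] at this
  exact this _ _ (hc σ τ hs)

/-! Extensionality laws. -/

theorem SemV.eta_unit {Γ : Ctx} {v : Val} (h : SemV Γ v v .unit) : SemV Γ v .unit .unit := by
  intro σ τ hs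
  have := h σ τ hs
  simp only [VTy.per] at this ⊢
  exact ⟨this.1, rfl⟩

theorem SemV.eta_fn {Γ : Ctx} {v : Val} {A : VTy} {C : CTy} (h : SemV Γ v v (.fn A C)) :
    SemV Γ v (.fn (.app v.shift (.var 0))) (.fn A C) := by
  intro σ τ hs
  have := h σ τ hs
  simp only [VTy.per] at this ⊢
  intro u u' hu
  refine C.per.symm (CTy.per_expand (.app_fn _ _) (C.per.symm ?_))
  rw [Comp.liftSub_subst_one]
  simp only [Comp.subst, Val.shift_subst_scons]
  exact this u u' hu

theorem SemC.eta_bool {Γ : Ctx} {v : Val} {c : Comp} {C : CTy} (hv : SemV Γ v v .bool)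
    (hc : SemC (.bool :: Γ) c c C) :
    SemC Γ (c.subst (one v)) (.ite v (c.subst (one .tt)) (c.subst (one .ff))) C := by
  intro σ τ hs
  have hb := hv σ τ hs
  have h := hc _ _ (by simpa only [ctxPER] using hs.scons hb)
  simp only [VTy.per] at hb
  simp only [Comp.subst, Comp.subst_subst, one_subst, Val.subst]
  refine C.per.symm ?_
  rcases hb with ⟨e, e'⟩ | ⟨e, e'⟩
  · rw [e'] at h ⊢
    exact CTy.per_expand (.ite_tt _ _) (C.per.symm h)
  · rw [e'] at h ⊢
    exact CTy.per_expand (.ite_ff _ _) (C.per.symm h)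

theorem SemC.eta_bind {Γ : Ctx} {c : Comp} {A : VTy} {S : Sig} {E : Theory}
    (h : SemC Γ c c (.mk A S E)) : SemC Γ c (.bind c (.ret (.var 0))) (.mk A S E) := by
  intro σ τ hs
  have := h σ τ hs
  simp only [CTy.per] at this ⊢
  exact CompRel.bind_ret_var this

theorem SemC.inherit {Γ : Ctx} {A : VTy} {S : Sig} {E : Theory} {X Z : Ctx} {T₁ T₂ : Tmpl}
    {f ρ : ℕ → Val} (hE : E.Valid S) (e : E.Mem X Z T₁ T₂)
    (hρ : ∀ i B, X[i]? = some B → SemV Γ (ρ i) (ρ i) B)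
    (hf : ∀ j B, Z[j]? = some B → SemV Γ (f j) (f j) (.fn B (.mk A S E))) :
    SemC Γ (T₁.inst f ρ) (T₂.inst f ρ) (.mk A S E) := by
  intro σ τ hs
  rw [Tmpl.inst_subst, Tmpl.inst_subst]
  simp only [CTy.per]
  obtain ⟨hT₁, hT₂⟩ := hE _ _ _ _ e
  refine .eqn (Theory.per_of_mem e) hT₁ hT₂ (envRel_of_get fun i B e => hρ i B e σ τ hs) ?_
  intro j Q e u u' hu
  obtain ⟨B, e', rfl⟩ := ctxPER_getElem?_eq_some e
  have := hf j B e' σ τ hs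
  simp only [VTy.per, CTy.per] at this
  exact this u u' hu

/-! Respecting theories. -/

theorem SemR.nil {Γ : Ctx} {h : Clauses} {S : Sig} {D : CTy}
    (H : ∀ σ τ, EnvRel (ctxPER Γ) σ τ → ClausesRel S.per D (h.subst σ) (h.subst τ)) :
    SemR Γ h .nil S D := by
  refine ⟨H, fun σ _ X Z T₁ T₂ e => ?_⟩
  simp [Theory.per] at e

/-- The environment which is given by `f` on the first `m` variables, by `σ` on the next `n`
variables, and by `τ` on the rest. -/
def envAppend (m n : ℕ) (f σ τ : ℕ → Val) (i : ℕ) : Val :=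
  if i < m then f i else if i - m < n then σ (i - m) else τ (i - m - n)

theorem envAppend_rel {Γ X Y : Ctx} {f g σ τ ρ ρ' : ℕ → Val} (hf : EnvRel (ctxPER Y) f g)
    (hs : EnvRel (ctxPER X) σ τ) (hρ : EnvRel (ctxPER Γ) ρ ρ') :
    EnvRel (ctxPER (Y ++ (X ++ Γ))) (envAppend Y.length X.length f σ ρ)
      (envAppend Y.length X.length g τ ρ') := by
  refine envRel_of_get fun n A e => ?_
  unfold envAppend
  split
  · rename_i h
    rw [List.getElem?_append_left h] at e
    exact hf.get e
  · rename_i h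
    rw [List.getElem?_append_right (not_lt.1 h)] at e
    split
    · rename_i h'
      rw [List.getElem?_append_left h'] at e
      exact hs.get e
    · rename_i h'
      rw [List.getElem?_append_right (not_lt.1 h')] at e
      exact hρ.get e

theorem WfT.handled_envAppend {X Z T S} (hT : WfT X Z T S) (h : Clauses) (f σ τ : ℕ → Val) :
    (T.handled (h.rename (· + (X.length + Z.length))) (fun j => .var j)
      (fun i => .var (i + Z.length))).subst (envAppend Z.length X.length f σ τ) =
    T.handled (h.subst τ) f σ := by
  rw [Tmpl.handled_subst, Clauses.rename_subst]
  have : (fun n => envAppend Z.length X.length f σ τ (n + (X.length + Z.length))) = τ := by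
    funext n
    unfold envAppend
    rw [if_neg (by omega), if_neg (by omega)]
    congr 1
    omega
  rw [this]
  refine hT.handled_congr _ (fun j hj => ?_) (fun i hi => ?_)
  · simp only [Val.subst, envAppend]; rw [if_pos hj]
  · simp only [Val.subst, envAppend]
    rw [if_neg (by omega), if_pos (by omega), Nat.add_sub_cancel]

theorem SemR.cons {Γ : Ctx} {h : Clauses} {E : Theory} {S : Sig} {D : CTy} {X Z : Ctx}
    {T₁ T₂ : Tmpl} (hR : SemR Γ h E S D) (hT : WfTheory S (.cons X Z T₁ T₂ E))
    (he : SemC (Z.map (fun B => VTy.fn B D) ++ (X ++ Γ))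
      (T₁.handled (h.rename (· + (X.length + Z.length))) (fun j => .var j)
        (fun i => .var (i + Z.length)))
      (T₂.handled (h.rename (· + (X.length + Z.length))) (fun j => .var j)
        (fun i => .var (i + Z.length))) D) :
    SemR Γ h (.cons X Z T₁ T₂ E) S D := by
  refine ⟨hR.1, fun ρ hρ X' Z' T₁' T₂' e f g σ τ hs hf => ?_⟩
  simp only [Theory.per] at e
  rcases e with ⟨rfl, rfl, rfl, rfl⟩ | e
  · cases hT with
    | cons _ _ _ hT₁ hT₂ =>
      have hfg : EnvRel (ctxPER (Z.map (fun B => VTy.fn B D))) f g := by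
        refine envRel_of_get fun j A e => ?_
        rw [List.getElem?_map, Option.map_eq_some_iff] at e
        obtain ⟨B, e, rfl⟩ := e
        simp only [VTy.per]
        exact hf j _ (ctxPER_getElem? e)
      have := he _ _ (envAppend_rel hfg hs hρ)
      rwa [List.length_map, hT₁.handled_envAppend, hT₂.handled_envAppend] at this
  · exact hR.2 ρ hρ X' Z' T₁' T₂' e f g σ τ hs hf

/-! ### Soundness of the logic -/

mutual
theorem WfC.valid : ∀ {C}, WfC C → C.Valid
  | _, .mk _ _ h => h.valid
termination_by structural _ h => h
theorem WfTheory.valid : ∀ {S E}, WfTheory S E → E.Valid S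
  | _, _, .nil _ => fun _ _ _ _ e => e.elim
  | _, _, .cons h _ _ h₁ h₂ => by
      have H := h.valid
      have H₁ := h₁.valid
      have H₂ := h₂.valid
      intro X' Z' T₁' T₂' e
      rcases e with ⟨rfl, rfl, rfl, rfl⟩ | e
      · exact ⟨H₁, H₂⟩
      · exact H _ _ _ _ e
termination_by structural _ _ h => h
theorem WfT.valid : ∀ {X Z T S}, WfT X Z T S → TmplValid S.per (ctxPER Z) (ctxPER X) T
  | _, _, _, _, .app _ _ hv hz => .app (ctxPER_getElem? hz) hv.sem
  | _, _, _, _, .ite hv h₁ h₂ => .ite (by simpa only [SemV, VTy.per] using hv.sem) h₁.valid h₂.valid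
  | _, _, _, _, .op e hv h =>
      .op (Sig.per_of_lookup e) hv.sem (by simpa only [ctxPER] using h.valid)
termination_by structural _ _ _ _ h => h
theorem HasTyV.sem : ∀ {Γ v A}, HasTyV Γ v A → SemV Γ v v A
  | _, _, _, .var _ e => .var e
  | _, _, _, .unit _ => .unit
  | _, _, _, .tt _ => .tt
  | _, _, _, .ff _ => .ff
  | _, _, _, .fn h => .fn h.sem
  | _, _, _, .handler h hR => .handler h.sem hR.sem.1 hR.sem hR.sem
  | _, _, _, .conv h e _ => h.sem.conv e
termination_by structural _ _ _ h => h
theorem HasTyC.sem : ∀ {Γ c C}, HasTyC Γ c C → SemC Γ c c C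
  | _, _, _, .ite h₁ h₂ h₃ => .ite h₁.sem h₂.sem h₃.sem
  | _, _, _, .app h₁ h₂ => .app h₁.sem h₂.sem
  | _, _, _, .ret h _ => .ret h.sem
  | _, _, _, .op e h₁ h₂ => .op e h₁.sem h₂.sem
  | _, _, _, .bind h₁ h₂ => .bind h₁.sem h₂.sem
  | _, _, _, .handle h₁ h₂ => .handle h₁.sem h₂.sem
  | _, _, _, .conv h e _ => h.sem.conv e
termination_by structural _ _ _ h => h
theorem HasTyH.sem : ∀ {Γ h S D}, HasTyH Γ h S D → ∀ σ τ, EnvRel (ctxPER Γ) σ τ →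
    ClausesRel S.per D (h.subst σ) (h.subst τ)
  | _, h, S, D, .mk _ _ _ _ hl hc => fun σ τ hs => by
      refine clausesRel_subst (fun o A B e => ?_) hs
      obtain ⟨co, hco⟩ := Option.ne_none_iff_exists'.1
        (show h.lookup o ≠ none from fun hn => by rw [(hl o).1 hn] at e; cases e)
      exact ⟨co, co, hco, hco, (hc o A B co e hco).sem⟩
termination_by structural _ _ _ _ h => h
theorem Respects.sem : ∀ {Γ h E S D}, Respects Γ h E S D → SemR Γ h E S D
  | _, _, _, _, _, .nil h => .nil h.sem
  | _, _, _, _, _, .cons h hT he => .cons h.sem hT he.sem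
termination_by structural _ _ _ _ _ h => h
theorem EqV.sem : ∀ {Γ v w A}, EqV Γ v w A → SemV Γ v w A
  | _, _, _, _, .refl h => h.sem
  | _, _, _, _, .symm h => h.sem.symm
  | _, _, _, _, .trans h₁ h₂ => h₁.sem.trans h₂.sem
  | _, _, _, _, .conv h e _ => h.sem.conv e
  | _, _, _, _, .subst h _ hs => h.sem.subst fun i B e => (hs i B e).sem
  | _, _, _, _, .fn h => .fn h.sem
  | Γ, _, _, _, .handler (S := S) (D := D) (h := h) (h' := h') hcr hR hR' hc => by
      have hR₁ := hR.sem
      have hR₂ := hR'.sem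
      refine .handler hcr.sem (fun σ τ hs => ?_) hR₁ hR₂
      refine clausesRel_subst (fun o A B e => ?_) hs
      obtain ⟨_, _, hco, -⟩ := hR₁.1 σ τ hs o _ _ (Sig.per_of_lookup e)
      obtain ⟨_, _, hco', -⟩ := hR₂.1 σ τ hs o _ _ (Sig.per_of_lookup e)
      obtain ⟨co, hco, -⟩ := Clauses.lookup_subst_eq_some hco
      obtain ⟨co', hco', -⟩ := Clauses.lookup_subst_eq_some hco'
      exact ⟨co, co', hco, hco', (hc o A B co co' e hco hco').sem⟩
  | _, _, _, _, .eta_unit h => h.sem.eta_unit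
  | _, _, _, _, .eta_fn h => h.sem.eta_fn
termination_by structural _ _ _ _ h => h
theorem EqC.sem : ∀ {Γ c d C}, EqC Γ c d C → SemC Γ c d C
  | _, _, _, _, .refl h => h.sem
  | _, _, _, _, .symm h => h.sem.symm
  | _, _, _, _, .trans h₁ h₂ => h₁.sem.trans h₂.sem
  | _, _, _, _, .conv h e _ => h.sem.conv e
  | _, _, _, _, .subst h _ hs => h.sem.subst fun i B e => (hs i B e).sem
  | _, _, _, _, .ite h₁ h₂ h₃ => .ite h₁.sem h₂.sem h₃.sem
  | _, _, _, _, .app h₁ h₂ => .app h₁.sem h₂.sem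
  | _, _, _, _, .ret h _ => .ret h.sem
  | _, _, _, _, .op e h₁ h₂ => .op e h₁.sem h₂.sem
  | _, _, _, _, .bind h₁ h₂ => .bind h₁.sem h₂.sem
  | _, _, _, _, .handle h₁ h₂ => .handle h₁.sem h₂.sem
  | _, _, _, _, .beta_tt h₁ h₂ => (SemC.ite .tt h₁.sem h₂.sem).reduce (.ite_tt _ _)
  | _, _, _, _, .beta_ff h₁ h₂ => (SemC.ite .ff h₁.sem h₂.sem).reduce (.ite_ff _ _)
  | _, _, _, _, .beta_fn h hv => (SemC.app (.fn h.sem) hv.sem).reduce (.app_fn _ _)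
  | _, _, _, _, .beta_bind_ret hv h => (SemC.bind (.ret hv.sem) h.sem).reduce (.bind_ret _ _)
  | _, _, _, _, .beta_bind_op e hv h₁ h₂ =>
      (SemC.bind (.op e hv.sem h₁.sem) h₂.sem).reduce (.bind_op _ _ _ _)
  | _, _, _, _, .beta_handle_ret h hR hv =>
      (SemC.handle (.handler h.sem hR.sem.1 hR.sem hR.sem) (.ret hv.sem)).reduce
        (.handle_ret _ _ _)
  | _, _, _, _, .beta_handle_op h hR e e' hv hc =>
      (SemC.handle (.handler h.sem hR.sem.1 hR.sem hR.sem) (.op e hv.sem hc.sem)).reduce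
        (.handle_op _ _ _ _ e')
  | _, _, _, _, .eta_bool hv h => .eta_bool hv.sem h.sem
  | _, _, _, _, .eta_bind h => .eta_bind h.sem
  | _, _, _, _, .inherit _ hC e hs hf =>
      .inherit hC.valid e (fun i B e => (hs i B e).sem) (fun j B e => (hf j B e).sem)
termination_by structural _ _ _ _ h => h
end

/-! ### Computation contexts preserve semantic equality -/

/-- Semantic equality of terms of the given sort. -/
def SemTm : (k : Kind) → Ctx → Tm k → Tm k → Ty k → Prop
  | .val => SemV
  | .comp => SemC

theorem HCx.lookup_plug {k : Kind} {t : Tm k} {o : ℕ} : ∀ {h : HCx k} {co : CCx k},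
    h.lookup o = some co → (h.plug t).lookup o = some (co.plug t)
  | .cons o' c h, co, e => by
      simp only [HCx.lookup] at e
      simp only [HCx.plug, Clauses.lookup]
      split at e
      · cases e; simp [*]
      · simpa [*] using HCx.lookup_plug e

mutual
theorem CxTyV.sem : ∀ {k Γ T Δ v A}, CxTyV k Γ T Δ v A → ∀ {t t' : Tm k},
    HasTy k Γ t T → HasTy k Γ t' T → SemTm k Γ t t' T → SemV Δ (v.plug t) (v.plug t') A
  | _, _, _, _, _, _, .hole _ hρ, t, t', _, _, hs => by
      simp only [VCx.plug]
      rw [Val.rename_eq_subst t, Val.rename_eq_subst t']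
      exact SemV.subst hs fun i B e => (hρ i B e).sem
  | _, _, _, _, _, _, .var _ e, _, _, _, _, _ => .var e
  | _, _, _, _, _, _, .unit _, _, _, _, _, _ => .unit
  | _, _, _, _, _, _, .tt _, _, _, _, _, _ => .tt
  | _, _, _, _, _, _, .ff _, _, _, _, _, _ => .ff
  | _, _, _, _, _, _, .fn h, _, _, ht, ht', hs => .fn (h.sem ht ht' hs)
  | _, _, _, _, _, _, .handler h hh hR _, t, t', ht, ht', hs =>
      .handler (h.sem ht ht' hs) (fun _ _ => hh.sem ht ht' hs) (hR t ht).sem (hR t' ht').sem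
  | _, _, _, _, _, _, .conv h e _, _, _, ht, ht', hs => (h.sem ht ht' hs).conv e
termination_by structural _ _ _ _ _ _ h => h
theorem CxTyC.sem : ∀ {k Γ T Δ c C}, CxTyC k Γ T Δ c C → ∀ {t t' : Tm k},
    HasTy k Γ t T → HasTy k Γ t' T → SemTm k Γ t t' T → SemC Δ (c.plug t) (c.plug t') C
  | _, _, _, _, _, _, .hole _ hρ, t, t', _, _, hs => by
      simp only [CCx.plug]
      rw [Comp.rename_eq_subst t, Comp.rename_eq_subst t']
      exact SemC.subst hs fun i B e => (hρ i B e).sem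
  | _, _, _, _, _, _, .ite h₁ h₂ h₃, _, _, ht, ht', hs =>
      .ite (h₁.sem ht ht' hs) (h₂.sem ht ht' hs) (h₃.sem ht ht' hs)
  | _, _, _, _, _, _, .app h₁ h₂, _, _, ht, ht', hs =>
      .app (h₁.sem ht ht' hs) (h₂.sem ht ht' hs)
  | _, _, _, _, _, _, .ret h _, _, _, ht, ht', hs => .ret (h.sem ht ht' hs)
  | _, _, _, _, _, _, .op e h₁ h₂, _, _, ht, ht', hs =>
      .op e (h₁.sem ht ht' hs) (h₂.sem ht ht' hs)
  | _, _, _, _, _, _, .bind h₁ h₂, _, _, ht, ht', hs =>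
      .bind (h₁.sem ht ht' hs) (h₂.sem ht ht' hs)
  | _, _, _, _, _, _, .handle h₁ h₂, _, _, ht, ht', hs =>
      .handle (h₁.sem ht ht' hs) (h₂.sem ht ht' hs)
  | _, _, _, _, _, _, .conv h e _, _, _, ht, ht', hs => (h.sem ht ht' hs).conv e
termination_by structural _ _ _ _ _ _ h => h
theorem CxTyH.sem : ∀ {k Γ T Δ h S D}, CxTyH k Γ T Δ h S D → ∀ {t t' : Tm k},
    HasTy k Γ t T → HasTy k Γ t' T → SemTm k Γ t t' T → ∀ {σ τ}, EnvRel (ctxPER Δ) σ τ →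
    ClausesRel S.per D ((h.plug t).subst σ) ((h.plug t').subst τ)
  | _, _, _, _, h, _, _, .mk _ _ _ _ hl hc, _, _, ht, ht', hs, _, _, he => by
      refine clausesRel_subst (fun o A B e => ?_) he
      obtain ⟨co, hco⟩ := Option.ne_none_iff_exists'.1
        (show h.lookup o ≠ none from fun hn => by rw [(hl o).1 hn] at e; cases e)
      exact ⟨_, _, HCx.lookup_plug hco, HCx.lookup_plug hco,
        (hc o A B co e hco).sem ht ht' hs⟩
termination_by structural _ _ _ _ _ _ _ h => h
end

/-- Well-typed terms that are semantically equal are contextually equivalent. -/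
theorem ctxEquiv_of_sem {k : Kind} {Γ : Ctx} {t t' : Tm k} {T : Ty k} (ht : HasTy k Γ t T)
    (ht' : HasTy k Γ t' T) (hs : SemTm k Γ t t' T) : CtxEquiv k Γ t t' T := by
  refine ⟨ht, ht', fun K hK => ?_⟩
  have := CxTyC.sem hK ht ht' hs .var .var (envRel_of_get fun n A e => by simp at e)
  rw [Comp.subst_var, Comp.subst_var] at this
  exact steps_ret_tt_iff this

end LocalEff

theorem mainTheorem4 :
    (∀ (Γ : LocalEff.Ctx) (v₁ v₂ : LocalEff.Val) (A : LocalEff.VTy),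
      LocalEff.EqV Γ v₁ v₂ A → LocalEff.CtxEquiv LocalEff.Kind.val Γ v₁ v₂ A) ∧
    (∀ (Γ : LocalEff.Ctx) (c₁ c₂ : LocalEff.Comp) (C : LocalEff.CTy),
      LocalEff.EqC Γ c₁ c₂ C → LocalEff.CtxEquiv LocalEff.Kind.comp Γ c₁ c₂ C) :=
  ⟨fun _ _ _ _ h => LocalEff.ctxEquiv_of_sem h.hasTyV.1 h.hasTyV.2 h.sem,
    fun _ _ _ _ h => LocalEff.ctxEquiv_of_sem h.hasTyC.1 h.hasTyC.2 h.sem⟩
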